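/- Let $K$ be a field of characteristic $0$ and let $q\in K$ be transcendental over $\mathbb{Q}$. Let $R=K[x]$, $\mathbb{Z}$-graded by $\deg x=1$, let $\beta(n,m)=q^{nm}$ for $n,m\in\mathbb{Z}$, and for $a\in\mathbb{Z}$ let $\sigma_a:R\to R$ be the linear map with $\sigma_a(x^m)=\beta(a,m)x^m$. Regard $\mathrm{End}_K(R)$ as an $R$-bimodule via $(r\varphi)(s)=r\varphi(s)$ and $(\varphi r)(s)=\varphi(rs)$, and put $[\varphi,r]_a=\varphi r-\sigma_a(r)\varphi$. Put $D^{-1}=0$ and, for $i\ge 0$, let $D^{i}$ be the $R$-subbimodule generated by those homogeneous $\varphi\in\mathrm{End}_K(R)$ (linear maps shifting all degrees by one fixed integer) for which there is $a\in\mathbb{Z}$ with $[\varphi,r]_a\in D^{i-1}$ for all $r\in R$. The algebra of quantum differential operators on $R$ is $D_q(K[x])=\bigcup_{i\ge 0}D^{i}\subseteq \mathrm{End}_K(R)$. For $a\in\{-1,0,1\}$ let $\partial_a\in \mathrm{End}_K(R)$ be given by $\partial_a(x^n)=(1+q^a+q^{2a}+\dots+q^{(n-1)a})\,x^{n-1}$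 for $n\ge 1$ and $\partial_a(1)=0$; write $\partial=\partial_0$, and write $x$ also for the operator of multiplication by $x$. Then the $K$-algebra $D_q(K[x])$ is generated by $x,\partial_1,\partial_{-1},\partial$, and it is presented by these generators subject to the relations $$\partial_a x-q^a x\partial_a=1\quad (a\in\{-1,0,1\}),$$ $$\partial_a x\,\partial_b=\partial_b x\,\partial_a\quad (a\ne b\in\{-1,0,1\}),$$ $$\partial_{-1}\partial_1=q\,\partial_1\partial_{-1}.$$ That is, if $E$ is the $K$-algebra defined by four generators $x,\partial_1,\partial_{-1},\partial$ and these relations, then there is an isomorphism of $K$-algebras $E\to D_q(K[x])$ that sends each generator to the operator of the same name. -/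

import Mathlib

/-! ### Quantum differential operators on a graded algebra -/

/-- A bicharacter on an abelian group `Γ` with values in the unit group of the field `K`. -/
structure Bicharacter (Γ K : Type*) [AddCommGroup Γ] [Field K] where
  val : Γ → Γ → Kˣ
  val_add_left : ∀ a b c, val (a + b) c = val a c * val b c
  val_add_right : ∀ a b c, val a (b + c) = val a b * val a c

namespace QuantumDiff

noncomputable section

section General

variable {K Γ R : Type*} [Field K] [AddCommGroup Γ] [DecidableEq Γ] [Ring R] [Algebra K R]
variable (𝒜 : Γ → Submodule K R) [GradedAlgebra 𝒜] (β : Bicharacter Γ K)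

/-- The map `σ_a` on `R`: it multiplies a homogeneous element of degree `d` by `β(a, d)`. -/
def sigma (a : Γ) : R →ₗ[K] R :=
  DirectSum.coeLinearMap 𝒜 ∘ₗ
    DirectSum.lmap (fun d => ((β.val a d : Kˣ) : K) • (LinearMap.id : 𝒜 d →ₗ[K] 𝒜 d)) ∘ₗ
      (DirectSum.decomposeLinearEquiv 𝒜).toLinearMap

/-- A linear map `R → R` is homogeneous if it shifts all degrees by one fixed element of `Γ`. -/
def IsHomogeneousMap (φ : Module.End K R) : Prop :=
  ∃ d : Γ, ∀ e : Γ, ∀ r ∈ 𝒜 e, φ r ∈ 𝒜 (d + e)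

/-- The twisted commutator `[φ, r]_a = φ r - σ_a(r) φ`.  Here `Module.End K R` is an
`R`-bimodule through left multiplication operators, acting on the left and on the right. -/
def bracket (a : Γ) (φ : Module.End K R) (r : R) : Module.End K R :=
  φ * LinearMap.mulLeft K r - LinearMap.mulLeft K (sigma 𝒜 β a r) * φ

/-- The `R`-subbimodule of `Module.End K R` generated by a set `S`: all sums of `r φ s` with
`φ ∈ S` and `r, s ∈ R`. -/
def bimoduleSpan (S : Set (Module.End K R)) : Submodule K (Module.End K R) :=
  Submodule.span K
    {ψ | ∃ φ ∈ S, ∃ r s : R, ψ = LinearMap.mulLeft K r * φ * LinearMap.mulLeft K s}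

/-- The subbimodule generated by the homogeneous `φ` for which there is `a ∈ Γ` such that
`[φ, r]_a ∈ N` for all `r ∈ R`. -/
def step (N : Submodule K (Module.End K R)) : Submodule K (Module.End K R) :=
  bimoduleSpan {φ | IsHomogeneousMap 𝒜 φ ∧ ∃ a : Γ, ∀ r : R, bracket 𝒜 β a φ r ∈ N}

/-- The bimodule of quantum differential operators of order at most `i`.  Order `0` is the
bimodule generated by the quantum centre. -/
def diffOpsOfOrder : ℕ → Submodule K (Module.End K R)
  | 0 => step 𝒜 β ⊥
  | i + 1 => step 𝒜 β (diffOpsOfOrder i)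

variable {𝒜 β}

theorem sigma_of_mem {a d : Γ} {r : R} (hr : r ∈ 𝒜 d) :
    sigma 𝒜 β a r = ((β.val a d : Kˣ) : K) • r := by
  lift r to 𝒜 d using hr
  simp [sigma]

theorem sigma_sigma (a b : Γ) (r : R) :
    sigma 𝒜 β a (sigma 𝒜 β b r) = sigma 𝒜 β (a + b) r := by
  induction r using DirectSum.Decomposition.inductionOn 𝒜 with
  | zero => simp
  | homogeneous m =>
    rw [sigma_of_mem m.2, map_smul, sigma_of_mem m.2, sigma_of_mem m.2, smul_smul,
      β.val_add_left, Units.val_mul, mul_comm]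
  | add m m' h h' => simp [h, h']

theorem sigma_zero (r : R) : sigma 𝒜 β 0 r = r := by
  have h0 : ∀ c, β.val 0 c = 1 := fun c => by
    have := β.val_add_left 0 0 c
    simpa using this
  induction r using DirectSum.Decomposition.inductionOn 𝒜 with
  | zero => simp
  | homogeneous m => rw [sigma_of_mem m.2, h0]; simp
  | add m m' h h' => simp [h, h']

theorem mem_bimoduleSpan {S : Set (Module.End K R)} {φ : Module.End K R} (h : φ ∈ S) :
    φ ∈ bimoduleSpan S :=
  Submodule.subset_span ⟨φ, h, 1, 1, by ext; simp⟩

theorem mulLeft_mul_mem {S : Set (Module.End K R)} {φ : Module.End K R}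
    (h : φ ∈ bimoduleSpan S) (t : R) : LinearMap.mulLeft K t * φ ∈ bimoduleSpan S := by
  induction h using Submodule.span_induction with
  | mem x hx =>
    obtain ⟨φ, hφ, r, s, rfl⟩ := hx
    exact Submodule.subset_span ⟨φ, hφ, t * r, s, by ext; simp [mul_assoc]⟩
  | zero => simp
  | add x y _ _ hx hy => rw [mul_add]; exact add_mem hx hy
  | smul c x _ hx => rw [mul_smul_comm]; exact Submodule.smul_mem _ _ hx

theorem mul_mulLeft_mem {S : Set (Module.End K R)} {φ : Module.End K R}
    (h : φ ∈ bimoduleSpan S) (t : R) : φ * LinearMap.mulLeft K t ∈ bimoduleSpan S := by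
  induction h using Submodule.span_induction with
  | mem x hx =>
    obtain ⟨φ, hφ, r, s, rfl⟩ := hx
    exact Submodule.subset_span ⟨φ, hφ, r, s * t, by ext; simp [mul_assoc]⟩
  | zero => simp
  | add x y _ _ hx hy => rw [add_mul]; exact add_mem hx hy
  | smul c x _ hx => rw [smul_mul_assoc]; exact Submodule.smul_mem _ _ hx

theorem step_mono {N N' : Submodule K (Module.End K R)} (h : N ≤ N') :
    step 𝒜 β N ≤ step 𝒜 β N' := by
  apply Submodule.span_mono
  rintro ψ ⟨φ, ⟨hφ, a, ha⟩, r, s, rfl⟩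
  exact ⟨φ, ⟨hφ, a, fun r => h (ha r)⟩, r, s, rfl⟩

/-- The layers `0, D⁰, D¹, …`, with the zero layer added in front. -/
def layer (𝒜 : Γ → Submodule K R) [GradedAlgebra 𝒜] (β : Bicharacter Γ K) :
    ℕ → Submodule K (Module.End K R)
  | 0 => ⊥
  | i + 1 => step 𝒜 β (layer 𝒜 β i)

theorem diffOpsOfOrder_eq_layer (i : ℕ) : diffOpsOfOrder 𝒜 β i = layer 𝒜 β (i + 1) := by
  induction i with
  | zero => rfl
  | succ i ih => rw [diffOpsOfOrder, ih]; rfl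

theorem layer_mono : Monotone (layer 𝒜 β) := by
  refine monotone_nat_of_le_succ fun n => ?_
  induction n with
  | zero => exact bot_le
  | succ n ih => exact step_mono ih

theorem diffOpsOfOrder_mono : Monotone (diffOpsOfOrder 𝒜 β) := fun i j h => by
  rw [diffOpsOfOrder_eq_layer, diffOpsOfOrder_eq_layer]
  exact layer_mono (by omega)

theorem mulLeft_mul_mem_layer {n : ℕ} {φ : Module.End K R} (h : φ ∈ layer 𝒜 β n) (t : R) :
    LinearMap.mulLeft K t * φ ∈ layer 𝒜 β n := by
  cases n with
  | zero => simp_all [layer]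
  | succ n => exact mulLeft_mul_mem h t

theorem mul_mulLeft_mem_layer {n : ℕ} {φ : Module.End K R} (h : φ ∈ layer 𝒜 β n) (t : R) :
    φ * LinearMap.mulLeft K t ∈ layer 𝒜 β n := by
  cases n with
  | zero => simp_all [layer]
  | succ n => exact mul_mulLeft_mem h t

theorem mul_mem_layer (n : ℕ) : ∀ i j : ℕ, i + j = n → ∀ φ ∈ layer 𝒜 β i, ∀ ψ ∈ layer 𝒜 β j,
    φ * ψ ∈ layer 𝒜 β n := by
  induction n using Nat.strong_induction_on with
  | _ n ih =>
  intro i j hij φ hφ ψ hψ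
  obtain _ | i := i
  · simp_all [layer]
  obtain _ | j := j
  · simp_all [layer]
  obtain ⟨m, rfl⟩ : ∃ m, n = m + 1 := ⟨i + j + 1, by omega⟩
  have ih1 : ∀ x ∈ layer 𝒜 β i, ∀ y ∈ layer 𝒜 β (j + 1), x * y ∈ layer 𝒜 β m :=
    ih m (by omega) i (j + 1) (by omega)
  have ih2 : ∀ x ∈ layer 𝒜 β (i + 1), ∀ y ∈ layer 𝒜 β j, x * y ∈ layer 𝒜 β m :=
    ih m (by omega) (i + 1) j (by omega)
  induction hφ using Submodule.span_induction with
  | zero => simp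
  | add x y _ _ hx hy => rw [add_mul]; exact add_mem hx hy
  | smul c x _ hx => rw [smul_mul_assoc]; exact Submodule.smul_mem _ _ hx
  | mem φ' hφ' =>
  obtain ⟨φ, ⟨⟨d, hd⟩, a, ha⟩, r, s, rfl⟩ := hφ'
  induction hψ using Submodule.span_induction with
  | zero => simp
  | add x y _ _ hx hy => rw [mul_add]; exact add_mem hx hy
  | smul c x _ hx => rw [mul_smul_comm]; exact Submodule.smul_mem _ _ hx
  | mem ψ' hψ' =>
  obtain ⟨ψ, ⟨⟨e, he⟩, b, hb⟩, t, u, rfl⟩ := hψ'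
  have hφm : φ ∈ layer 𝒜 β (i + 1) := mem_bimoduleSpan ⟨⟨d, hd⟩, a, ha⟩
  have hψm : ψ ∈ layer 𝒜 β (j + 1) := mem_bimoduleSpan ⟨⟨e, he⟩, b, hb⟩
  have key : φ * ψ ∈ layer 𝒜 β (m + 1) := by
    refine mem_bimoduleSpan ⟨⟨d + e, fun f x hx => ?_⟩, a + b, fun x => ?_⟩
    · rw [add_assoc]; exact hd _ _ (he _ _ hx)
    · have : bracket 𝒜 β (a + b) (φ * ψ) x =
          bracket 𝒜 β a φ (sigma 𝒜 β b x) * ψ + φ * bracket 𝒜 β b ψ x := by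
        simp only [bracket, ← sigma_sigma, mul_sub, sub_mul, mul_assoc]
        abel
      rw [this]
      exact add_mem (ih1 _ (ha _) _ hψm) (ih2 _ hφm _ (hb _))
  have : LinearMap.mulLeft K r * φ * LinearMap.mulLeft K s *
        (LinearMap.mulLeft K t * ψ * LinearMap.mulLeft K u) =
      LinearMap.mulLeft K r * (LinearMap.mulLeft K (sigma 𝒜 β a (s * t)) * (φ * ψ) +
        bracket 𝒜 β a φ (s * t) * ψ) * LinearMap.mulLeft K u := by
    rw [bracket, LinearMap.mulLeft_mul]
    change _ = LinearMap.mulLeft K r * (LinearMap.mulLeft K (sigma 𝒜 β a (s * t)) * (φ * ψ) +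
      (φ * (LinearMap.mulLeft K s * LinearMap.mulLeft K t) - _ * φ) * ψ) * _
    simp only [mul_sub, sub_mul, mul_add, add_mul, mul_assoc]
    abel
  rw [this]
  refine mul_mulLeft_mem_layer (mulLeft_mul_mem_layer (add_mem ?_ ?_) _) _
  · exact mulLeft_mul_mem_layer key _
  · exact layer_mono (Nat.le_succ m) (ih1 _ (ha _) _ hψm)

theorem mulLeft_mem_diffOpsOfOrder (r : R) :
    LinearMap.mulLeft K r ∈ diffOpsOfOrder 𝒜 β 0 := by
  have h1 : (1 : Module.End K R) ∈ diffOpsOfOrder 𝒜 β 0 := by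
    refine mem_bimoduleSpan ⟨⟨0, fun e x hx => by simpa using hx⟩, 0, fun x => ?_⟩
    simp [bracket, sigma_zero]
  have h2 := mulLeft_mul_mem h1 r
  rwa [mul_one] at h2

variable (𝒜 β)

/-- The algebra `D_q(R)` of quantum differential operators: the union of the bimodules of
operators of order at most `i`. -/
def diffOps : Subalgebra K (Module.End K R) where
  carrier := {φ | ∃ i, φ ∈ diffOpsOfOrder 𝒜 β i}
  mul_mem' := by
    rintro φ ψ ⟨i, hi⟩ ⟨j, hj⟩
    rw [diffOpsOfOrder_eq_layer] at hi hj
    refine ⟨i + j + 1, ?_⟩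
    rw [diffOpsOfOrder_eq_layer]
    exact mul_mem_layer _ (i + 1) (j + 1) (by omega) φ hi ψ hj
  add_mem' := by
    rintro φ ψ ⟨i, hi⟩ ⟨j, hj⟩
    exact ⟨max i j, add_mem (diffOpsOfOrder_mono (le_max_left i j) hi)
      (diffOpsOfOrder_mono (le_max_right i j) hj)⟩
  algebraMap_mem' := fun c => by
    refine ⟨0, ?_⟩
    convert mulLeft_mem_diffOpsOfOrder (𝒜 := 𝒜) (β := β) (algebraMap K R c) using 1
    ext x
    simp [Algebra.smul_def]

end General

/-! ### The polynomial algebra in one variable -/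

section Poly

open Polynomial

variable (K : Type*) [Field K]

/-- The `ℤ`-grading of `K[x]` with `deg x = 1`: degree `d` is spanned by the `x ^ n`, `n = d`. -/
def polyGrading (d : ℤ) : Submodule K K[X] :=
  Submodule.span K {p | ∃ n : ℕ, (n : ℤ) = d ∧ p = X ^ n}

theorem X_pow_mem_polyGrading (n : ℕ) : (X ^ n : K[X]) ∈ polyGrading K n :=
  Submodule.subset_span ⟨n, rfl, rfl⟩

instance : SetLike.GradedMonoid (polyGrading K) where
  one_mem := by simpa using X_pow_mem_polyGrading K 0
  mul_mem := by
    intro i j p r hp hr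
    have h : polyGrading K i * polyGrading K j ≤ polyGrading K (i + j) := by
      rw [polyGrading, polyGrading, Submodule.span_mul_span, Submodule.span_le]
      rintro _ ⟨_, ⟨n, rfl, rfl⟩, _, ⟨m, rfl, rfl⟩, rfl⟩
      have := X_pow_mem_polyGrading K (n + m)
      rw [pow_add] at this
      exact_mod_cast this
    exact h (Submodule.mul_mem_mul hp hr)

/-- The map that splits a polynomial into its homogeneous components. -/
def polyDecompose : K[X] →ₗ[K] DirectSum ℤ (fun d => polyGrading K d) :=
  (basisMonomials K).constr K fun n =>
    DirectSum.lof K ℤ (fun d => polyGrading K d) n ⟨X ^ n, X_pow_mem_polyGrading K n⟩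

theorem polyDecompose_X_pow (n : ℕ) : polyDecompose K (X ^ n) =
    DirectSum.lof K ℤ (fun d => polyGrading K d) n ⟨X ^ n, X_pow_mem_polyGrading K n⟩ := by
  have := (basisMonomials K).constr_basis K (fun n : ℕ =>
    DirectSum.lof K ℤ (fun d => polyGrading K d) n ⟨X ^ n, X_pow_mem_polyGrading K n⟩) n
  rw [polyDecompose]
  simpa only [coe_basisMonomials, monomial_one_right_eq_X_pow] using this

instance : DirectSum.Decomposition (polyGrading K) :=
  DirectSum.Decomposition.ofLinearMap (polyGrading K) (polyDecompose K)
    (by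
      refine (basisMonomials K).ext fun n => ?_
      simp only [coe_basisMonomials, monomial_one_right_eq_X_pow, LinearMap.comp_apply,
        polyDecompose_X_pow]
      simp)
    (by
      refine DirectSum.linearMap_ext K fun d => LinearMap.ext fun ⟨p, hp⟩ => ?_
      simp only [LinearMap.comp_apply, DirectSum.coeLinearMap_lof, LinearMap.id_apply]
      induction hp using Submodule.span_induction with
      | mem p hp => obtain ⟨n, rfl, rfl⟩ := hp; exact polyDecompose_X_pow K n
      | zero => rw [map_zero]; exact (map_zero _).symm
      | add p r _ _ h1 h2 => rw [map_add, h1, h2, ← map_add]; rfl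
      | smul c p _ h => rw [map_smul, h, ← map_smul]; rfl)

instance : GradedAlgebra (polyGrading K) where

variable {K}

/-- The bicharacter `β(n, m) = q ^ (n m)` on `ℤ`. -/
def qBicharacter (q : K) (hq : q ≠ 0) : Bicharacter ℤ K where
  val n m := Units.mk0 q hq ^ (n * m)
  val_add_left a b c := by rw [add_mul, zpow_add]
  val_add_right a b c := by rw [mul_add, zpow_add]

theorem ne_zero_of_transcendental [CharZero K] {q : K} (hq : Transcendental ℚ q) : q ≠ 0 := by
  rintro rfl
  exact hq isAlgebraic_zero

/-- The `q`-number `1 + m + ⋯ + m ^ (n - 1)`. -/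
def qNumber (n : ℕ) (m : K) : K := ∑ i ∈ Finset.range n, m ^ i

/-- The operator `∂_a : x ^ n ↦ [n]_{q ^ a} x ^ (n - 1)` on `K[x]`, for `a ∈ {-1, 0, 1}`
(it kills `1`, since `[0] = 0`).  The set `{-1, 0, 1}` is the type `SignType`. -/
def del (q : K) (a : SignType) : Module.End K K[X] :=
  (basisMonomials K).constr K fun n : ℕ => qNumber n (q ^ (a : ℤ)) • (X : K[X]) ^ (n - 1)

/-- The four symbols `x, ∂_{-1}, ∂_0 = ∂, ∂_1`. -/
inductive Gen : Type
  | x : Gen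
  | d (a : SignType) : Gen

open FreeAlgebra in
/-- The defining relations on the free algebra on the four symbols. -/
inductive Rel (q : K) : FreeAlgebra K Gen → FreeAlgebra K Gen → Prop
  | weyl (a : SignType) :
      Rel q (ι K (Gen.d a) * ι K Gen.x - q ^ (a : ℤ) • (ι K Gen.x * ι K (Gen.d a))) 1
  | exchange (a b : SignType) (hab : a ≠ b) :
      Rel q (ι K (Gen.d a) * ι K Gen.x * ι K (Gen.d b))
        (ι K (Gen.d b) * ι K Gen.x * ι K (Gen.d a))
  | qcomm :
      Rel q (ι K (Gen.d (-1)) * ι K (Gen.d 1)) (q • (ι K (Gen.d 1) * ι K (Gen.d (-1))))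

/-- The `K`-algebra presented by the four generators and the defining relations. -/
abbrev PresentedAlg (q : K) : Type _ := RingQuot (Rel q)

/-- The image of a symbol in the presented algebra. -/
def PresentedAlg.gen (q : K) (g : Gen) : PresentedAlg q :=
  RingQuot.mkAlgHom K (Rel q) (FreeAlgebra.ι K g)

end Poly

end

end QuantumDiff

/-! A homogeneous operator of degree `e` has the form x^n ↦ f(n) x^(n+e), and everything is read off
its symbol f. It lies in D_q(K[x]) exactly when f is a quasi-polynomial, f(n) = F(n, q^n) with F in
K[X][T;T⁻¹]; for negative `e` such an f must vanish where n + e < 0.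

Operators: the bracket with x turns f(n) into f(n+1) - q^a f(n). A twisted difference equation with
quasi-polynomial right side has only quasi-polynomial solutions
(`exists_laurentEval_eq_of_difference`), so by induction on the order D_q(K[x]) stays inside the
image of E, once that image is known to realise every admissible symbol. In degree 0, the elements
x∂ and 1 + (q-1)x∂_1 act as X and T, and the latter is invertible by the relations
(`sigInv_mul_sig`). In degree -k-1, the symbols of ∂u + ∂_1 v are combinations of X - k and T - q^k,
which generate the ideal of the point (k, q^k) (`exists_of_laurentEval_eq_zero`,
`exists_mem_lower_hasSymbol`).

Relations: E is the sum of its graded parts (`iSup_homog`), so faithfulness on K[x] is checked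
degree by degree. In degree 0, F is determined by its values because the powers q^b are distinct
(`eq_zero_of_laurentEval_eq_zero`). In negative degree, a vanishing ∂u + ∂_1 v gives a syzygy of X -
k and T - q^k; it is a Koszul syzygy, and it is killed by the relation ∂x∂_1 = ∂_1x∂
(`eq_zero_of_mem_lower`). -/

namespace QuantumDiff

noncomputable section

open Polynomial LaurentPolynomial

/-! ### Homomorphisms out of K[X][T;T⁻¹]. -/

section LaurentHom

variable {K A : Type*} [Field K] [Ring A] [Algebra K A]

/-- The homomorphism `K[X][T;T⁻¹] → A` with `X ↦ a` and `T ↦ u`, for commuting `a` and `u`. -/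
def laurentHom (a : A) (u : Aˣ) (h : Commute a u) : K[X][T;T⁻¹] →+* A :=
  AddMonoidAlgebra.liftNCRingHom (aeval a : K[X] →ₐ[K] A).toRingHom
    ((Units.coeHom A).comp (zpowersHom Aˣ u)) (by
      intro p n
      have h1 : Commute a ((u ^ n.toAdd : Aˣ) : A) := by
        have := h.units_zpow_right n.toAdd
        exact this
      change Commute (aeval a p) ((u ^ n.toAdd : Aˣ) : A)
      induction p using Polynomial.induction_on' with
      | add p r hp hr => rw [map_add]; exact hp.add_left hr
      | monomial i c =>
        rw [aeval_monomial]
        exact (Algebra.commute_algebraMap_left c _).mul_left (h1.pow_left i))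

variable (a : A) (u : Aˣ) (h : Commute a u)

theorem laurentHom_C (p : K[X]) :
    laurentHom a u h (LaurentPolynomial.C p) = aeval a p := by
  rw [← single_eq_C]
  change AddMonoidAlgebra.liftNC _ _ _ = _
  rw [AddMonoidAlgebra.liftNC_single]
  simp

theorem laurentHom_T (n : ℤ) :
    laurentHom (K := K) a u h (T n) = ((u ^ n : Aˣ) : A) := by
  rw [T]
  change AddMonoidAlgebra.liftNC _ _ _ = _
  rw [AddMonoidAlgebra.liftNC_single]
  simp

end LaurentHom

/-! ### Quasi-polynomials: uniqueness, and the ideal of a point (k, q^k). -/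

section Eval

variable {K : Type*} [Field K] {q : K}

/-- The value of a Laurent polynomial at the point `X = m`, `T = q ^ m`. -/
def laurentEval (hq : q ≠ 0) (m : ℤ) : K[X][T;T⁻¹] →+* K :=
  laurentHom (m : K) (Units.mk0 q hq ^ m) (Commute.all _ _)

@[simp] theorem laurentEval_C (hq : q ≠ 0) (m : ℤ) (p : K[X]) :
    laurentEval hq m (LaurentPolynomial.C p) = p.eval (m : K) := by
  rw [laurentEval, laurentHom_C, coe_aeval_eq_eval]

@[simp] theorem laurentEval_T (hq : q ≠ 0) (m n : ℤ) :
    laurentEval hq m (T n) = q ^ (m * n) := by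
  rw [laurentEval, laurentHom_T, ← zpow_mul, Units.val_zpow_eq_zpow_val, Units.val_mk0]

theorem sum_C_mul_T (f : K[X][T;T⁻¹]) :
    f.coeff.sum (fun b p => LaurentPolynomial.C p * T b) = f := by
  simp_rw [← single_eq_C_mul_T]
  exact AddMonoidAlgebra.sum_coeff_single f

/-- The shift operator on sequences. -/
def seqShift (K : Type*) [Field K] : Module.End K (ℕ → K) := LinearMap.funLeft K K Nat.succ

/-- The operator shift - q^b replaces p by q^b (p(X+1) - p), which has smaller degree, so some power
of it kills the sequence. -/
theorem polyExp_mem_maxGenEigenspace (hq : q ≠ 0) (b : ℤ) (p : K[X]) :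
    (fun n : ℕ => p.eval (n : K) * q ^ (n * b)) ∈ (seqShift K).maxGenEigenspace (q ^ b) := by
  rw [Module.End.mem_maxGenEigenspace]
  have key : ∀ (p : K[X]),
      ((seqShift K) - q ^ b • (1 : Module.End K (ℕ → K)))
        (fun n : ℕ => p.eval (n : K) * q ^ (n * b)) =
        (fun n : ℕ => (Polynomial.C (q ^ b) * (p.comp (X + 1) - p)).eval (n : K) * q ^ (n * b)) := by
    intro p
    ext n
    simp only [seqShift, LinearMap.sub_apply, LinearMap.smul_apply, Module.End.one_apply,
      Pi.sub_apply, Pi.smul_apply, LinearMap.funLeft_apply, smul_eq_mul, eval_mul, Polynomial.eval_C,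
      eval_sub, eval_comp, eval_add, eval_X, eval_one]
    push_cast
    rw [add_mul, zpow_add₀ hq, one_mul]
    ring
  have deg : ∀ p : K[X], p.natDegree ≠ 0 →
      (Polynomial.C (q ^ b) * (p.comp (X + 1) - p)).natDegree < p.natDegree := by
    intro p hp
    refine lt_of_le_of_lt (natDegree_C_mul_le _ _) ?_
    have h0 : p ≠ 0 := by rintro rfl; simp at hp
    by_cases hd : p.comp (X + 1) - p = 0
    · rw [hd]; simpa using Nat.pos_of_ne_zero hp
    · refine natDegree_lt_natDegree hd ?_
      rw [← Polynomial.C_1]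
      have hdeg : (p.comp (X + Polynomial.C 1)).degree = p.degree := by
        rw [← taylor_apply, degree_taylor]
      rw [← hdeg]
      refine degree_sub_lt_left hdeg ?_ ?_
      · rw [Ne, ← degree_eq_bot, hdeg, degree_eq_bot]; exact h0
      · rw [← taylor_apply, leadingCoeff_taylor]
  induction hd : p.natDegree using Nat.strong_induction_on generalizing p with
  | _ d ih =>
    by_cases h0 : p.natDegree = 0
    · refine ⟨1, ?_⟩
      rw [pow_one, key, eq_C_of_natDegree_eq_zero h0]
      ext n; simp
    · obtain ⟨k, hk⟩ := ih _ (hd ▸ deg p h0) _ rfl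
      exact ⟨k + 1, by rw [pow_succ, Module.End.mul_apply, key]; exact hk⟩

/-- Generalised eigenspaces of the shift for the distinct eigenvalues q^b are independent, so each
term p_b(n) q^(nb) vanishes separately. Then p_b has all natural numbers as roots, infinitely many
in characteristic zero. -/
theorem eq_zero_of_laurentEval_eq_zero [CharZero K] (hq : q ≠ 0) (hqi : Function.Injective fun b : ℤ => q ^ b)
    {f : K[X][T;T⁻¹]} (hf : ∀ n : ℕ, laurentEval hq n f = 0) : f = 0 := by
  have hind := ((seqShift K).independent_maxGenEigenspace).comp hqi
  have hsum : ∑ b ∈ f.coeff.support,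
      (fun n : ℕ => (f.coeff b).eval (n : K) * q ^ (n * b)) = 0 := by
    ext n
    have := hf n
    rw [← sum_C_mul_T f, Finsupp.sum, map_sum] at this
    simpa [Finset.sum_apply] using this
  have hz : ∀ b ∈ f.coeff.support,
      (fun n : ℕ => (f.coeff b).eval (n : K) * q ^ (n * b)) = 0 := by
    classical
    refine (iSupIndep_iff_finsetSum_eq_zero_imp_eq_zero _).1 hind _ _ ?_ hsum
    intro b _
    exact polyExp_mem_maxGenEigenspace hq b _
  ext1 b
  by_contra hb
  refine hb ?_
  have h1 := hz b (by simpa using hb)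
  refine Polynomial.eq_zero_of_infinite_isRoot _ ?_
  refine Set.Infinite.mono ?_ (Set.infinite_range_of_injective (Nat.cast_injective (R := K)))
  rintro _ ⟨n, rfl⟩
  have := congrFun h1 n
  simpa [zpow_ne_zero _ hq] using this

theorem coeff_C_mul (p : K[X]) (f : K[X][T;T⁻¹]) (b : ℤ) :
    (LaurentPolynomial.C p * f).coeff b = p * f.coeff b := by
  rw [← LaurentPolynomial.smul_eq_C_mul]; rfl

theorem coeff_T_one_mul (f : K[X][T;T⁻¹]) (b : ℤ) :
    (T 1 * f).coeff b = f.coeff (b - 1) := by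
  have := AddMonoidAlgebra.coeff_single_mul_add f (1 : K[X]) (1 : ℤ) (b - 1)
  rw [one_mul] at this
  rw [← this, T]
  congr 1
  ring

theorem exists_eq_C_X_sub_C_mul (c : K) {f : K[X][T;T⁻¹]}
    (hf : ∀ b, (f.coeff b).eval c = 0) :
    ∃ g, f = LaurentPolynomial.C (X - Polynomial.C c) * g := by
  refine ⟨f.coeff.sum fun b p => LaurentPolynomial.C (p /ₘ (X - Polynomial.C c)) * T b, ?_⟩
  conv_lhs => rw [← sum_C_mul_T f]
  rw [Finsupp.sum, Finsupp.sum, Finset.mul_sum]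
  refine Finset.sum_congr rfl fun b _ => ?_
  rw [← mul_assoc, ← map_mul, mul_divByMonic_eq_iff_isRoot.2 (hf b)]

/-- The elements X - c and T - d have only Koszul syzygies. Modulo X - c the relation says that T -
d kills `f₁`, which forces `f₁` to vanish there. -/
theorem exists_factor_of_C_mul_add_T_sub_mul {c d : K} (hd : d ≠ 0) {f₀ f₁ : K[X][T;T⁻¹]}
    (h : LaurentPolynomial.C (X - Polynomial.C c) * f₀ +
      (T 1 - LaurentPolynomial.C (Polynomial.C d)) * f₁ = 0) :
    ∃ g, f₁ = LaurentPolynomial.C (X - Polynomial.C c) * g ∧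
      f₀ = -((T 1 - LaurentPolynomial.C (Polynomial.C d)) * g) := by
  have hrec : ∀ b, (f₁.coeff (b - 1)).eval c = d * (f₁.coeff b).eval c := by
    intro b
    have := congrArg (fun f : K[X][T;T⁻¹] => (f.coeff b).eval c) h
    simp only [sub_mul (T 1)] at this
    simp only [AddMonoidAlgebra.coeff_add, AddMonoidAlgebra.coeff_sub, Finsupp.add_apply,
      Finsupp.sub_apply, coeff_C_mul, coeff_T_one_mul, AddMonoidAlgebra.coeff_zero,
      Finsupp.zero_apply] at this
    simp only [eval_add, eval_sub, eval_mul, eval_X, Polynomial.eval_C, eval_zero] at this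
    linear_combination this
  have hzero : ∀ b, (f₁.coeff b).eval c = 0 := by
    intro b
    by_contra hb
    -- By `hrec` one nonzero coefficient at X = c propagates to all lower exponents, against finite
    -- support.
    have hne : ∀ m : ℕ, (f₁.coeff (b - m)).eval c ≠ 0 := by
      intro m
      induction m with
      | zero => simpa using hb
      | succ m ih =>
        have := hrec (b - m)
        rw [show b - ((m + 1 : ℕ) : ℤ) = b - m - 1 by push_cast; ring, this]
        exact mul_ne_zero hd ih
    have hinf : (Set.range fun m : ℕ => b - (m : ℤ)).Infinite :=
      Set.infinite_range_of_injective fun m n hmn => by simpa using hmn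
    refine hinf (f₁.coeff.support.finite_toSet.subset ?_)
    rintro _ ⟨m, rfl⟩
    have := hne m
    simp only [Finset.mem_coe, Finsupp.mem_support_iff]
    intro h0
    simp [h0] at this
  obtain ⟨g, rfl⟩ := exists_eq_C_X_sub_C_mul c hzero
  refine ⟨g, rfl, ?_⟩
  have hX : LaurentPolynomial.C (X - Polynomial.C c) ≠ 0 := by
    intro h0
    have := congrArg (fun f : K[X][T;T⁻¹] => f.coeff 0) h0
    simp only [LaurentPolynomial.C_apply] at this
    exact X_sub_C_ne_zero c this
  refine eq_neg_of_add_eq_zero_left (mul_left_cancel₀ hX ?_)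
  rw [mul_zero, ← h]
  ring

/-- Modulo the two generators X becomes k and T becomes q^k, so every Laurent polynomial is
congruent to its value at the point. -/
theorem exists_of_laurentEval_eq_zero (hq : q ≠ 0) (k : ℤ) {f : K[X][T;T⁻¹]}
    (hf : laurentEval hq k f = 0) :
    ∃ g h, f = LaurentPolynomial.C (X - Polynomial.C (k : K)) * g +
      (T 1 - LaurentPolynomial.C (Polynomial.C (q ^ k))) * h := by
  set I : Ideal K[X][T;T⁻¹] := Ideal.span {LaurentPolynomial.C (X - Polynomial.C (k : K)),
      T 1 - LaurentPolynomial.C (Polynomial.C (q ^ k))} with hI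
  have hX : LaurentPolynomial.C (X - Polynomial.C (k : K)) ∈ I :=
    Ideal.subset_span (by simp)
  have hT : T 1 - LaurentPolynomial.C (Polynomial.C (q ^ k)) ∈ I :=
    Ideal.subset_span (by simp)
  have hC : ∀ p : K[X], LaurentPolynomial.C p -
      LaurentPolynomial.C (Polynomial.C (p.eval (k : K))) ∈ I := by
    intro p
    obtain ⟨r, hr⟩ := X_sub_C_dvd_sub_C_eval (p := p) (a := (k : K))
    rw [← map_sub, hr, map_mul]
    exact I.mul_mem_right _ hX
  have hTn : ∀ b : ℤ, T b - LaurentPolynomial.C (Polynomial.C (q ^ (k * b))) ∈ I := by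
    intro b
    rw [← Ideal.Quotient.eq]
    induction b using Int.induction_on with
    | zero => simp
    | succ b ih =>
      rw [T_add, map_mul, ih, (Ideal.Quotient.eq).2 hT, ← map_mul, ← map_mul, ← map_mul, mul_add,
        mul_one, zpow_add₀ hq]
    | pred b ih =>
      -- Negative exponents: T is a unit in the quotient, so one factor T may be restored and
      -- cancelled.
      have hu : IsUnit (Ideal.Quotient.mk I (T 1)) := (isUnit_T 1).map _
      refine hu.mul_left_injective ?_
      beta_reduce
      rw [← map_mul, ← T_add, sub_add_cancel, ih, (Ideal.Quotient.eq).2 hT, ← map_mul, ← map_mul,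
        ← map_mul, ← zpow_add₀ hq]
      congr 4
      ring
  have key : ∀ f, f - LaurentPolynomial.C (Polynomial.C (laurentEval hq k f)) ∈ I := by
    intro f
    induction f using LaurentPolynomial.induction_on' with
    | add f g hf hg =>
      rw [map_add, map_add, map_add, add_sub_add_comm]
      exact I.add_mem hf hg
    | C_mul_T b p =>
      rw [map_mul, laurentEval_C, laurentEval_T, map_mul, map_mul, ← Ideal.Quotient.eq, map_mul,
        map_mul, (Ideal.Quotient.eq).2 (hC p), (Ideal.Quotient.eq).2 (hTn b)]
  have := key f
  rw [hf, map_zero, map_zero, sub_zero, hI, Ideal.mem_span_pair] at this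
  obtain ⟨g, h, e⟩ := this
  exact ⟨g, h, by rw [← e]; ring⟩

end Eval

/-! ### Twisted difference equations. -/

section Difference

variable {K : Type*} [Field K] [CharZero K] {q : K}

/-- The operator is triangular on monomials. If c ≠ d, X^m maps to (c-d)X^m plus lower terms. If c =
d, X^(m+1) maps to c(m+1)X^m plus lower terms, with nonzero leading coefficient in characteristic
zero. -/
theorem exists_polynomial_difference {c d : K} (hc : c ≠ 0) (p : K[X]) :
    ∃ r : K[X], Polynomial.C c * r.comp (X + 1) - Polynomial.C d * r = p := by
  let S : K[X] →ₗ[K] K[X] := c • Polynomial.taylor (1 : K) - d • LinearMap.id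
  have hS : ∀ r, S r = Polynomial.C c * r.comp (X + 1) - Polynomial.C d * r := by
    intro r
    simp [S, taylor_apply, Polynomial.smul_eq_C_mul]
  suffices h : LinearMap.range S = ⊤ by
    obtain ⟨r, hr⟩ := LinearMap.range_eq_top.1 h p
    exact ⟨r, by rw [← hS, hr]⟩
  have hX : ∀ m : ℕ, (X ^ m : K[X]) ∈ LinearMap.range S := by
    intro m
    induction m using Nat.strong_induction_on with
    | _ m ih =>
    -- The lower part of the binomial expansion of (X+1)^M; it is used with M = m + 1 if c = d and M
    -- = m otherwise.
    have hlow : ∀ M : ℕ, ∑ j ∈ Finset.range m, (X : K[X]) ^ j * 1 ^ (M - j) * (M.choose j : K[X]) ∈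
        LinearMap.range S := by
      intro M
      refine Submodule.sum_mem _ fun j hj => ?_
      have : (X : K[X]) ^ j * 1 ^ (M - j) * (M.choose j : K[X]) = (M.choose j : K) • X ^ j := by
        rw [Polynomial.smul_eq_C_mul, one_pow, mul_one, mul_comm]; simp
      rw [this]
      exact Submodule.smul_mem _ _ (ih j (Finset.mem_range.1 hj))
    by_cases hcd : c = d
    · have h1 : S (X ^ (m + 1)) ∈ LinearMap.range S := ⟨_, rfl⟩
      rw [hS, X_pow_comp, add_pow, Finset.sum_range_succ, Finset.sum_range_succ, ← hcd] at h1
      have h2 := Submodule.sub_mem _ h1 (Submodule.smul_mem _ c (hlow (m + 1)))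
      have hne : c * (m + 1 : K) ≠ 0 := mul_ne_zero hc (Nat.cast_add_one_ne_zero m)
      rw [← Submodule.smul_mem_iff _ hne]
      convert! h2 using 1
      simp only [Polynomial.smul_eq_C_mul, Nat.choose_self, Nat.choose_succ_self_right, one_pow,
        Polynomial.C_mul, Polynomial.C_add, Polynomial.C_1, Polynomial.C_eq_natCast]
      push_cast
      ring
    · have h1 : S (X ^ m) ∈ LinearMap.range S := ⟨_, rfl⟩
      rw [hS, X_pow_comp, add_pow, Finset.sum_range_succ] at h1
      have h2 := Submodule.sub_mem _ h1 (Submodule.smul_mem _ c (hlow m))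
      rw [← Submodule.smul_mem_iff _ (sub_ne_zero.2 hcd)]
      convert! h2 using 1
      simp only [Polynomial.smul_eq_C_mul, Nat.choose_self, one_pow, Polynomial.C_sub]
      push_cast
      ring
  rw [eq_top_iff]
  intro p _
  induction p using Polynomial.induction_on' with
  | add p r hp hr => exact Submodule.add_mem _ (hp trivial) (hr trivial)
  | monomial n a =>
    rw [← C_mul_X_pow_eq_monomial, ← Polynomial.smul_eq_C_mul]
    exact Submodule.smul_mem _ _ (hX n)

theorem exists_laurent_difference (hq : q ≠ 0) (a : ℤ) (h : K[X][T;T⁻¹]) :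
    ∃ f : K[X][T;T⁻¹], ∀ n : ℕ, laurentEval hq ((n + 1 : ℕ) : ℤ) f - q ^ a * laurentEval hq n f =
      laurentEval hq n h := by
  induction h using LaurentPolynomial.induction_on' with
  | add h₁ h₂ ih₁ ih₂ =>
    obtain ⟨f₁, h₁⟩ := ih₁
    obtain ⟨f₂, h₂⟩ := ih₂
    refine ⟨f₁ + f₂, fun n => ?_⟩
    simp only [map_add]
    linear_combination h₁ n + h₂ n
  | C_mul_T b p =>
    obtain ⟨r, hr⟩ := exists_polynomial_difference (d := q ^ a) (zpow_ne_zero b hq) p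
    refine ⟨LaurentPolynomial.C r * T b, fun n => ?_⟩
    simp only [map_mul, laurentEval_C, laurentEval_T, ← hr, eval_sub, eval_mul, eval_comp,
      Polynomial.eval_C, eval_add, eval_X, eval_one]
    push_cast
    rw [add_mul, zpow_add₀ hq, one_mul]
    ring

/-- A sequence whose twisted difference is a quasi-polynomial is a quasi-polynomial. -/
theorem exists_laurentEval_eq_of_difference (hq : q ≠ 0) (a : ℤ) (h : K[X][T;T⁻¹]) {g : ℕ → K}
    (hg : ∀ n, g (n + 1) - q ^ a * g n = laurentEval hq n h) :
    ∃ f : K[X][T;T⁻¹], ∀ n : ℕ, g n = laurentEval hq n f := by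
  obtain ⟨f, hf⟩ := exists_laurent_difference hq a h
  -- The homogeneous equation is solved by the multiples of q^(an), the values of T^a; the constant
  -- matches the two sequences at n = 0.
  refine ⟨f + LaurentPolynomial.C (Polynomial.C (g 0 - laurentEval hq 0 f)) * T a, fun n => ?_⟩
  simp only [map_add, map_mul, laurentEval_C, laurentEval_T, Polynomial.eval_C]
  induction n with
  | zero => simp
  | succ n ih =>
    have h1 := hg n
    have h2 := hf n
    push_cast at h2 ⊢
    rw [add_mul, zpow_add₀ hq, one_mul]
    linear_combination h1 - h2 + q ^ a * ih

end Difference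

end

end QuantumDiff

namespace QuantumDiff

noncomputable section

open Polynomial LaurentPolynomial

/-! ### Symbols of homogeneous operators. -/

section Symbol

variable {K : Type*} [Field K]

/-- The operator `φ` maps `X ^ n` to `f n • X ^ (n + e)`, which is zero if `n + e < 0`. -/
def HasSymbol (φ : Module.End K K[X]) (e : ℤ) (f : ℕ → K) : Prop :=
  ∀ n : ℕ, φ (X ^ n) = f n • X ^ ((n : ℤ) + e).toNat ∧ ((n : ℤ) + e < 0 → f n = 0)

namespace HasSymbol

variable {φ ψ : Module.End K K[X]} {e : ℤ} {f g : ℕ → K}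

theorem congr (h : HasSymbol φ e f) (hfg : ∀ n, f n = g n) : HasSymbol φ e g := by
  rwa [← funext hfg]

theorem add (h : HasSymbol φ e f) (h' : HasSymbol ψ e g) :
    HasSymbol (φ + ψ) e fun n => f n + g n := fun n =>
  ⟨by rw [LinearMap.add_apply, (h n).1, (h' n).1, add_smul],
    fun hn => by beta_reduce; rw [(h n).2 hn, (h' n).2 hn, add_zero]⟩

theorem smul (c : K) (h : HasSymbol φ e f) : HasSymbol (c • φ) e fun n => c * f n := fun n =>
  ⟨by rw [LinearMap.smul_apply, (h n).1, smul_smul], fun hn => by beta_reduce; rw [(h n).2 hn, mul_zero]⟩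

theorem ext_of_X_pow (h : ∀ n : ℕ, φ (X ^ n) = ψ (X ^ n)) : φ = ψ :=
  (basisMonomials K).ext fun n => by
    simpa only [coe_basisMonomials, monomial_one_right_eq_X_pow] using h n

theorem unique (h : HasSymbol φ e f) (h' : HasSymbol ψ e f) : φ = ψ :=
  ext_of_X_pow fun n => by rw [(h n).1, (h' n).1]

theorem zero (e : ℤ) : HasSymbol (0 : Module.End K K[X]) e fun _ => 0 := fun n => by simp

theorem symbol_eq_zero (h : HasSymbol φ e f) (hφ : φ = 0) (n : ℕ) : f n = 0 := by
  have := (h n).1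
  rw [hφ, LinearMap.zero_apply] at this
  exact (smul_eq_zero.1 this.symm).resolve_right (pow_ne_zero _ X_ne_zero)

theorem X_mul (h : HasSymbol φ e f) : HasSymbol (LinearMap.mulLeft K X * φ) (e + 1) f := by
  intro n
  refine ⟨?_, fun hn => (h n).2 (by omega)⟩
  rw [Module.End.mul_apply, (h n).1, LinearMap.mulLeft_apply, mul_smul_comm]
  rcases lt_or_ge ((n : ℤ) + e) 0 with hn | hn
  · rw [(h n).2 hn, zero_smul, zero_smul]
  · rw [← pow_succ', ← add_assoc, Int.toNat_add hn zero_le_one]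
    rfl

theorem of_X_mul (h : HasSymbol φ e f) :
    HasSymbol (φ * LinearMap.mulLeft K X) (e + 1) fun n => f (n + 1) := by
  intro n
  have := h (n + 1)
  push_cast at this
  rw [Module.End.mul_apply, LinearMap.mulLeft_apply, ← pow_succ', this.1,
    show (n : ℤ) + (e + 1) = n + 1 + e by ring]
  exact ⟨rfl, this.2⟩

end HasSymbol

theorem del_X_pow (q : K) (a : SignType) (n : ℕ) :
    del q a (X ^ n) = qNumber n (q ^ (a : ℤ)) • (X : K[X]) ^ (n - 1) := by
  have := (basisMonomials K).constr_basis K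
    (fun n : ℕ => qNumber n (q ^ (a : ℤ)) • (X : K[X]) ^ (n - 1)) n
  rw [del]
  simpa only [coe_basisMonomials, monomial_one_right_eq_X_pow] using this

theorem HasSymbol.del {φ : Module.End K K[X]} {e : ℤ} {f : ℕ → K} (h : HasSymbol φ e f) (q : K)
    (a : SignType) :
    HasSymbol (del q a * φ) (e - 1)
      fun n => qNumber ((n : ℤ) + e).toNat (q ^ (a : ℤ)) * f n := by
  intro n
  constructor
  · rw [Module.End.mul_apply, (h n).1, map_smul, del_X_pow, smul_smul, mul_comm]
    congr 2
    omega
  · intro hn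
    beta_reduce
    rcases lt_or_ge ((n : ℤ) + e) 0 with hn' | hn'
    · rw [(h n).2 hn', mul_zero]
    · rw [show ((n : ℤ) + e).toNat = 0 by omega]
      simp [qNumber]

/-- The truncation in `toNat` does no harm: where n + e is negative, f n is already zero. -/
theorem HasSymbol.del_zero {φ : Module.End K K[X]} {e : ℤ} {f : ℕ → K} (h : HasSymbol φ e f)
    (q : K) : HasSymbol (QuantumDiff.del q 0 * φ) (e - 1) fun n => ((n + e : ℤ) : K) * f n := by
  refine (h.del q 0).congr fun n => ?_
  rcases lt_or_ge ((n : ℤ) + e) 0 with hn | hn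
  · rw [(h n).2 hn, mul_zero, mul_zero]
  · congr 1
    lift (n : ℤ) + e to ℕ using hn with m
    simp [qNumber]

theorem HasSymbol.del_one {φ : Module.End K K[X]} {e : ℤ} {f : ℕ → K} (h : HasSymbol φ e f)
    {q : K} (hq1 : q ≠ 1) :
    HasSymbol (QuantumDiff.del q 1 * φ) (e - 1)
      fun n => (q - 1)⁻¹ * (q ^ ((n : ℤ) + e) - 1) * f n := by
  refine (h.del q 1).congr fun n => ?_
  rcases lt_or_ge ((n : ℤ) + e) 0 with hn | hn
  · rw [(h n).2 hn, mul_zero, mul_zero]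
  · congr 1
    lift (n : ℤ) + e to ℕ using hn with m
    simp [qNumber, geom_sum_eq hq1, div_eq_inv_mul]

/-- The coefficients of the degree `e` component of an operator. -/
def symbolAt (e : ℤ) : Module.End K K[X] →ₗ[K] ℕ → K where
  toFun φ n := if (n : ℤ) + e < 0 then 0 else (φ (X ^ n)).coeff ((n : ℤ) + e).toNat
  map_add' φ ψ := by ext n; by_cases h : (n : ℤ) + e < 0 <;> simp [h]
  map_smul' c φ := by ext n; by_cases h : (n : ℤ) + e < 0 <;> simp [h]

theorem HasSymbol.symbolAt_self {φ : Module.End K K[X]} {e : ℤ} {f : ℕ → K}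
    (h : HasSymbol φ e f) : symbolAt e φ = f := by
  ext n
  by_cases hn : (n : ℤ) + e < 0
  · simp [symbolAt, hn, (h n).2 hn]
  · simp [symbolAt, hn, (h n).1]

theorem HasSymbol.symbolAt_of_ne {φ : Module.End K K[X]} {e e' : ℤ} {f : ℕ → K}
    (h : HasSymbol φ e f) (he : e' ≠ e) : symbolAt e' φ = 0 := by
  ext n
  by_cases hn : (n : ℤ) + e' < 0
  · simp [symbolAt, hn]
  · by_cases hn' : (n : ℤ) + e < 0
    · simp [symbolAt, (h n).1, (h n).2 hn']
    · have : ((n : ℤ) + e').toNat ≠ ((n : ℤ) + e).toNat := by omega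
      simp [symbolAt, (h n).1, coeff_X_pow, this]

end Symbol

/-! ### The graded structure of E, derived from the relations alone. -/

/-- An algebra `E` generated by elements `x`, `d a` that satisfy the relations of the quantum
differential operators, with a representation by these operators on `K[X]`. -/
structure QuantumWeylRep {K : Type*} [Field K] (q : K) (E : Type*) [Ring E] [Algebra K E] where
  x : E
  d : SignType → E
  rep : E →ₐ[K] Module.End K K[X]
  weyl : ∀ a, d a * x = q ^ (a : ℤ) • (x * d a) + 1
  exchange : ∀ a b, d a * x * d b = d b * x * d a
  qcomm : d (-1) * d 1 = q • (d 1 * d (-1))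
  rep_x : rep x = LinearMap.mulLeft K X
  rep_d : ∀ a, rep (d a) = del q a
  adjoin_eq_top : Algebra.adjoin K (insert x (Set.range d)) = ⊤

namespace QuantumWeylRep

variable {K E : Type*} [Field K] [Ring E] [Algebra K E] {q : K} (D : QuantumWeylRep q E)

/-- The Euler element `x * d a`. -/
def euler (a : SignType) : E := D.x * D.d a

theorem euler_comm (a b : SignType) : D.euler a * D.euler b = D.euler b * D.euler a := by
  have := congrArg (D.x * ·) (D.exchange a b)
  simpa only [euler, mul_assoc] using this

theorem d_mul_euler (a b : SignType) :
    D.d a * D.euler b = D.d a + q ^ (b : ℤ) • (D.euler b * D.d a) := by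
  rw [euler, ← mul_assoc, D.exchange a b, D.weyl b, add_mul, one_mul, add_comm, smul_mul_assoc]

theorem euler_mul_x (a : SignType) :
    D.euler a * D.x = D.x * (1 + q ^ (a : ℤ) • D.euler a) := by
  rw [euler, mul_assoc, D.weyl a, add_comm]

/-- The element that acts on `X ^ n` as multiplication by `q ^ n`. -/
def sig : E := 1 + (q - 1) • D.euler 1

/-- The inverse of `sig`. -/
def sigInv : E := 1 + (q⁻¹ - 1) • D.euler (-1)

/-- The product ∂_{-1} x ∂_1 is computed twice: by the Weyl relation for ∂_{-1} and q-commutation,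
and by exchange and the Weyl relation for ∂_1. Comparison gives (q-1) x∂_1∂_{-1} = ∂_1 - ∂_{-1}. -/
theorem d_neg_one_mul_sig (hq : q ≠ 0) : D.d (-1) * D.sig = q • D.d 1 := by
  have h1 : D.d (-1) * D.euler 1 = D.d 1 + D.x * D.d 1 * D.d (-1) := by
    rw [euler, ← mul_assoc, D.exchange, ← sub_eq_zero]
    rw [← D.exchange, D.weyl, add_mul, smul_mul_assoc, mul_assoc, D.qcomm, mul_smul_comm,
      smul_smul, mul_assoc]
    simp [hq, add_comm]
  have h2 : D.d (-1) * D.euler 1 = D.d (-1) + q • (D.x * D.d 1 * D.d (-1)) := by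
    rw [d_mul_euler, euler]
    simp
  have h3 : (q - 1) • (D.x * D.d 1 * D.d (-1)) = D.d 1 - D.d (-1) := by
    rw [sub_smul, one_smul, sub_eq_sub_iff_add_eq_add, add_comm, ← h2, h1]
  rw [sig, mul_add, mul_one, mul_smul_comm, h1, smul_add, h3, sub_smul, one_smul]
  abel

theorem euler_neg_one_mul_sig (hq : q ≠ 0) : D.euler (-1) * D.sig = q • D.euler 1 := by
  rw [euler, mul_assoc, d_neg_one_mul_sig D hq, mul_smul_comm, euler]

theorem sigInv_mul_sig (hq : q ≠ 0) : D.sigInv * D.sig = 1 := by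
  rw [sigInv, add_mul, one_mul, smul_mul_assoc, euler_neg_one_mul_sig D hq, smul_smul, sig,
    add_assoc, ← add_smul, show q - 1 + (q⁻¹ - 1) * q = 0 by field_simp; ring, zero_smul, add_zero]

theorem commute_euler_sig (a : SignType) : Commute (D.euler a) D.sig :=
  (Commute.one_right _).add_right (Commute.smul_right (D.euler_comm a 1) _)

theorem sig_mul_sigInv (hq : q ≠ 0) : D.sig * D.sigInv = 1 := by
  have : Commute D.sigInv D.sig :=
    (Commute.one_left _).add_left (Commute.smul_left (D.commute_euler_sig (-1)) _)
  rw [← this.eq, D.sigInv_mul_sig hq]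

/-- `sig` as a unit. -/
@[simps]
def sigUnit (hq : q ≠ 0) : Eˣ := ⟨D.sig, D.sigInv, D.sig_mul_sigInv hq, D.sigInv_mul_sig hq⟩

theorem d_neg_one (hq : q ≠ 0) : D.d (-1) = q • (D.d 1 * D.sigInv) := by
  rw [← smul_mul_assoc, ← D.d_neg_one_mul_sig hq, mul_assoc, D.sig_mul_sigInv hq, mul_one]

theorem commute_euler_sigUnit (hq : q ≠ 0) (a : SignType) :
    Commute (D.euler a) (D.sigUnit hq : E) :=
  D.commute_euler_sig a

/-- The homomorphism from Laurent polynomials onto the degree zero part of `E`. -/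
def ofLaurent (hq : q ≠ 0) : K[X][T;T⁻¹] →+* E :=
  laurentHom (D.euler 0) (D.sigUnit hq) (D.commute_euler_sigUnit hq 0)

theorem ofLaurent_smul (hq : q ≠ 0) (c : K) (f : K[X][T;T⁻¹]) :
    D.ofLaurent hq (LaurentPolynomial.C (Polynomial.C c) * f) = c • D.ofLaurent hq f := by
  rw [map_mul, ofLaurent, laurentHom_C, aeval_C, Algebra.smul_def]

theorem ofLaurent_X (hq : q ≠ 0) :
    D.ofLaurent hq (LaurentPolynomial.C X) = D.euler 0 := by
  rw [ofLaurent, laurentHom_C, aeval_X]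

theorem ofLaurent_T_one (hq : q ≠ 0) : D.ofLaurent hq (T 1) = D.sig := by
  rw [ofLaurent, laurentHom_T, zpow_one, val_sigUnit]

theorem ofLaurent_T_neg_one (hq : q ≠ 0) : D.ofLaurent hq (T (-1)) = D.sigInv := by
  rw [ofLaurent, laurentHom_T, zpow_neg_one, val_inv_sigUnit]

/-- The part of degree `-k` of `E`. -/
def lower (hq : q ≠ 0) : ℕ → Submodule K E
  | 0 =>
    { carrier := Set.range (D.ofLaurent hq)
      add_mem' := by rintro _ _ ⟨f, rfl⟩ ⟨g, rfl⟩; exact ⟨f + g, map_add _ _ _⟩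
      zero_mem' := ⟨0, map_zero _⟩
      smul_mem' := by rintro c _ ⟨f, rfl⟩; exact ⟨_, D.ofLaurent_smul hq c f⟩ }
  -- The generator ∂_{-1} is not needed: by `d_neg_one` it is ∂_1 times a unit of degree zero, up to
  -- a scalar.
  | k + 1 => (lower hq k).map (LinearMap.mulLeft K (D.d 0)) ⊔
      (lower hq k).map (LinearMap.mulLeft K (D.d 1))

/-- The part of degree `k` of `E`. -/
def upper (hq : q ≠ 0) : ℕ → Submodule K E
  | 0 => D.lower hq 0
  | k + 1 => (upper hq k).map (LinearMap.mulLeft K D.x)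

theorem mem_lower_succ {hq : q ≠ 0} {k : ℕ} {w : E} :
    w ∈ D.lower hq (k + 1) ↔
      ∃ u ∈ D.lower hq k, ∃ v ∈ D.lower hq k, D.d 0 * u + D.d 1 * v = w := by
  simp only [lower, Submodule.mem_sup, Submodule.mem_map, LinearMap.mulLeft_apply]
  constructor
  · rintro ⟨_, ⟨u, hu, rfl⟩, _, ⟨v, hv, rfl⟩, rfl⟩
    exact ⟨u, hu, v, hv, rfl⟩
  · rintro ⟨u, hu, v, hv, rfl⟩
    exact ⟨_, ⟨u, hu, rfl⟩, _, ⟨v, hv, rfl⟩, rfl⟩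

theorem mem_upper_succ {hq : q ≠ 0} {k : ℕ} {w : E} :
    w ∈ D.upper hq (k + 1) ↔ ∃ u ∈ D.upper hq k, D.x * u = w := by
  simp only [upper, Submodule.mem_map, LinearMap.mulLeft_apply]

theorem smul_sub_one_mem {V : Submodule K E} {c : K} (hc : c ≠ 0) {y w : E} (hw : w ∈ V)
    (h : (1 + c • y) * w ∈ V) : y * w ∈ V := by
  rw [← Submodule.smul_mem_iff _ hc]
  convert! V.sub_mem h hw using 1
  rw [add_mul, one_mul, add_sub_cancel_left, smul_mul_assoc]

/-- In degree zero, x∂ corresponds to X, and the other two Euler elements are recovered from the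
actions of T and T⁻¹. In lower degree, `d_mul_euler` moves an Euler element past the leading ∂_b. -/
theorem euler_mul_mem_lower (hq : q ≠ 0) (hq1 : q ≠ 1) (a : SignType) (k : ℕ) :
    ∀ w ∈ D.lower hq k, D.euler a * w ∈ D.lower hq k := by
  induction k with
  | zero =>
    rintro _ ⟨f, rfl⟩
    have hf : D.ofLaurent hq f ∈ D.lower hq 0 := ⟨f, rfl⟩
    match a with
    | 0 => exact ⟨LaurentPolynomial.C X * f, by rw [map_mul, ofLaurent_X]⟩
    | 1 =>
      refine smul_sub_one_mem (sub_ne_zero.2 hq1) hf ?_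
      exact ⟨T 1 * f, by rw [map_mul, ofLaurent_T_one]; rfl⟩
    | -1 =>
      refine smul_sub_one_mem (sub_ne_zero.2 (inv_ne_one.2 hq1)) hf ?_
      exact ⟨T (-1) * f, by rw [map_mul, ofLaurent_T_neg_one]; rfl⟩
  | succ k ih =>
    have key : ∀ b, (∀ u ∈ D.lower hq k, D.d b * u ∈ D.lower hq (k + 1)) →
        ∀ u ∈ D.lower hq k, D.euler a * (D.d b * u) ∈ D.lower hq (k + 1) := by
      intro b hb u hu
      rw [← Submodule.smul_mem_iff _ (zpow_ne_zero (a : ℤ) hq)]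
      convert! Submodule.sub_mem _ (hb _ (ih u hu)) (hb _ hu) using 1
      rw [← mul_assoc, ← mul_assoc, D.d_mul_euler, add_mul, add_sub_cancel_left, smul_mul_assoc]
    intro w hw
    obtain ⟨u, hu, v, hv, rfl⟩ := D.mem_lower_succ.1 hw
    rw [mul_add]
    refine Submodule.add_mem _ (key 0 (fun u hu => ?_) u hu) (key 1 (fun u hu => ?_) v hv)
    · exact D.mem_lower_succ.2 ⟨u, hu, 0, Submodule.zero_mem _, by simp⟩
    · exact D.mem_lower_succ.2 ⟨0, Submodule.zero_mem _, u, hu, by simp⟩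

theorem d_mul_mem_lower (hq : q ≠ 0) (hq1 : q ≠ 1) (a : SignType) {k : ℕ} {w : E}
    (hw : w ∈ D.lower hq k) : D.d a * w ∈ D.lower hq (k + 1) := by
  match a with
  | 0 => exact D.mem_lower_succ.2 ⟨w, hw, 0, Submodule.zero_mem _, by simp⟩
  | 1 => exact D.mem_lower_succ.2 ⟨0, Submodule.zero_mem _, w, hw, by simp⟩
  | -1 =>
    refine D.mem_lower_succ.2 ⟨0, Submodule.zero_mem _, q • (D.sigInv * w), ?_, ?_⟩
    · refine Submodule.smul_mem _ _ ?_
      rw [sigInv, add_mul, one_mul, smul_mul_assoc]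
      exact Submodule.add_mem _ hw (Submodule.smul_mem _ _ (D.euler_mul_mem_lower hq hq1 _ _ _ hw))
    · rw [D.d_neg_one hq, mul_zero, zero_add, mul_smul_comm, smul_mul_assoc, mul_assoc]

theorem x_mul_mem_lower (hq : q ≠ 0) (hq1 : q ≠ 1) {k : ℕ} {w : E}
    (hw : w ∈ D.lower hq (k + 1)) : D.x * w ∈ D.lower hq k := by
  obtain ⟨u, hu, v, hv, rfl⟩ := D.mem_lower_succ.1 hw
  rw [mul_add, ← mul_assoc, ← mul_assoc]
  exact Submodule.add_mem _ (D.euler_mul_mem_lower hq hq1 0 k u hu)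
    (D.euler_mul_mem_lower hq hq1 1 k v hv)

/-- This factor is ∂_a x. By `euler_mul_x`, moving the Euler element past x produces the same factor
again, so the induction closes. -/
theorem one_add_euler_mul_mem_upper (hq : q ≠ 0) (hq1 : q ≠ 1) (a : SignType) (k : ℕ) :
    ∀ w ∈ D.upper hq k, (1 + q ^ (a : ℤ) • D.euler a) * w ∈ D.upper hq k := by
  induction k with
  | zero =>
    intro w hw
    rw [add_mul, one_mul, smul_mul_assoc]
    exact Submodule.add_mem _ hw (Submodule.smul_mem _ _ (D.euler_mul_mem_lower hq hq1 a 0 w hw))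
  | succ k ih =>
    intro w hw
    obtain ⟨u, hu, rfl⟩ := D.mem_upper_succ.1 hw
    rw [add_mul, one_mul, smul_mul_assoc, ← mul_assoc, euler_mul_x, mul_assoc]
    exact Submodule.add_mem _ hw (Submodule.smul_mem _ _
      (D.mem_upper_succ.2 ⟨_, ih u hu, rfl⟩))

theorem d_mul_mem_upper (hq : q ≠ 0) (hq1 : q ≠ 1) (a : SignType) {k : ℕ} {w : E}
    (hw : w ∈ D.upper hq (k + 1)) : D.d a * w ∈ D.upper hq k := by
  obtain ⟨u, hu, rfl⟩ := D.mem_upper_succ.1 hw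
  rw [← mul_assoc, D.weyl, add_comm]
  exact D.one_add_euler_mul_mem_upper hq hq1 a k u hu

/-- The part of degree `e` of `E`. -/
def homog (hq : q ≠ 0) : ℤ → Submodule K E
  | .ofNat k => D.upper hq k
  | .negSucc k => D.lower hq (k + 1)

/-- The sum of the graded parts contains 1 and is stable under left multiplication by the
generators, hence by all of E. -/
theorem iSup_homog (hq : q ≠ 0) (hq1 : q ≠ 1) : ⨆ e, D.homog hq e = ⊤ := by
  set M := ⨆ e, D.homog hq e with hM
  have hle : ∀ e, D.homog hq e ≤ M := le_iSup _
  have hx : M ≤ M.comap (LinearMap.mulLeft K D.x) := by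
    refine iSup_le fun e w hw => ?_
    match e with
    | .ofNat k => exact hle (.ofNat (k + 1)) (D.mem_upper_succ.2 ⟨w, hw, rfl⟩)
    | .negSucc 0 => exact hle (.ofNat 0) (D.x_mul_mem_lower hq hq1 hw)
    | .negSucc (k + 1) => exact hle (.negSucc k) (D.x_mul_mem_lower hq hq1 hw)
  have hd : ∀ a, M ≤ M.comap (LinearMap.mulLeft K (D.d a)) := by
    intro a
    refine iSup_le fun e w hw => ?_
    match e with
    | .ofNat 0 => exact hle (.negSucc 0) (D.d_mul_mem_lower hq hq1 a hw)
    | .ofNat (k + 1) => exact hle (.ofNat k) (D.d_mul_mem_upper hq hq1 a hw)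
    | .negSucc k => exact hle (.negSucc (k + 1)) (D.d_mul_mem_lower hq hq1 a hw)
  have h1 : (1 : E) ∈ M := hle (.ofNat 0) ⟨1, map_one _⟩
  have hall : ∀ y : E, ∀ w ∈ M, y * w ∈ M := by
    intro y
    have hy : y ∈ Algebra.adjoin K (insert D.x (Set.range D.d)) := D.adjoin_eq_top ▸ trivial
    induction hy using Algebra.adjoin_induction with
    | mem y hy =>
      rcases hy with rfl | ⟨a, rfl⟩
      · exact fun w hw => hx hw
      · exact fun w hw => hd a hw
    | algebraMap c => exact fun w hw => by rw [← Algebra.smul_def]; exact M.smul_mem c hw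
    | add y z _ _ hy hz => exact fun w hw => by rw [add_mul]; exact M.add_mem (hy w hw) (hz w hw)
    | mul y z _ _ hy hz => exact fun w hw => by rw [mul_assoc]; exact hy _ (hz w hw)
  exact eq_top_iff.2 fun y _ => by simpa using hall y 1 h1

end QuantumWeylRep

end

end QuantumDiff

namespace QuantumDiff

noncomputable section

open Polynomial LaurentPolynomial

theorem ne_one_of_zpow_injective {K : Type*} [Field K] {q : K}
    (hqi : Function.Injective fun b : ℤ => q ^ b) : q ≠ 1 := by
  rintro rfl
  have := @hqi 0 1 (by simp)
  omega

/-! ### Symbols of elements of E, and faithfulness of the representation. -/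

namespace QuantumWeylRep

variable {K E : Type*} [Field K] [Ring E] [Algebra K E] {q : K} (D : QuantumWeylRep q E)

theorem rep_euler_zero_X_pow (n : ℕ) :
    D.rep (D.euler 0) (X ^ n) = (n : K) • (X : K[X]) ^ n := by
  rw [euler, map_mul, D.rep_x, D.rep_d, Module.End.mul_apply, del_X_pow, map_smul,
    LinearMap.mulLeft_apply]
  cases n with
  | zero => simp [qNumber]
  | succ n => rw [add_tsub_cancel_right, ← pow_succ']; simp [qNumber]

theorem rep_sig_X_pow (n : ℕ) :
    D.rep D.sig (X ^ n) = q ^ n • (X : K[X]) ^ n := by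
  rw [sig, map_add, map_smul, euler, map_mul, D.rep_x, D.rep_d, map_one, LinearMap.add_apply,
    LinearMap.smul_apply, Module.End.mul_apply, del_X_pow, map_smul, LinearMap.mulLeft_apply,
    Module.End.one_apply]
  cases n with
  | zero => simp [qNumber]
  | succ n =>
    rw [add_tsub_cancel_right, ← pow_succ', smul_smul]
    nth_rw 1 [← one_smul K ((X : K[X]) ^ (n + 1))]
    rw [← add_smul]
    congr 1
    have := mul_geom_sum q (n + 1)
    simp [qNumber, this]

theorem rep_sigUnit_zpow_X_pow (hq : q ≠ 0) (b : ℤ) (n : ℕ) :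
    D.rep ((D.sigUnit hq ^ b : Eˣ) : E) (X ^ n) = q ^ ((n : ℤ) * b) • (X : K[X]) ^ n := by
  have hinv : D.rep D.sigInv (X ^ n) = (q ^ n)⁻¹ • (X : K[X]) ^ n := by
    have h := congrArg (fun y => D.rep y (X ^ n)) (D.sigInv_mul_sig hq)
    simp only [map_mul, Module.End.mul_apply, D.rep_sig_X_pow, map_smul, map_one,
      Module.End.one_apply] at h
    rw [← h, smul_smul, inv_mul_cancel₀ (pow_ne_zero n hq), one_smul]
    simp only [h]
  induction b using Int.induction_on with
  | zero => simp
  | succ b ih =>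
    rw [zpow_add_one, Units.val_mul, val_sigUnit, map_mul, Module.End.mul_apply,
      D.rep_sig_X_pow, map_smul, ih, smul_smul, mul_add, mul_one, zpow_add₀ hq, zpow_natCast,
      mul_comm]
  | pred b ih =>
    rw [zpow_sub_one, Units.val_mul, val_inv_sigUnit, map_mul, Module.End.mul_apply,
      hinv, map_smul, ih, smul_smul, mul_sub, mul_one, zpow_sub₀ hq, zpow_natCast,
      div_eq_inv_mul]

theorem rep_ofLaurent_X_pow (hq : q ≠ 0) (f : K[X][T;T⁻¹]) (n : ℕ) :
    D.rep (D.ofLaurent hq f) (X ^ n) = laurentEval hq n f • (X : K[X]) ^ n := by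
  induction f using LaurentPolynomial.induction_on' with
  | add f g hf hg => rw [map_add, map_add, LinearMap.add_apply, hf, hg, map_add, add_smul]
  | C_mul_T b p =>
    rw [map_mul, map_mul, map_mul, Module.End.mul_apply, laurentEval_C, laurentEval_T, ofLaurent,
      laurentHom_T, laurentHom_C, D.rep_sigUnit_zpow_X_pow hq, map_smul, ← aeval_algHom_apply,
      mul_comm (eval _ p), mul_smul]
    congr 1
    induction p using Polynomial.induction_on' with
    | add p r hp hr => rw [map_add, LinearMap.add_apply, hp, hr, eval_add, add_smul]
    | monomial i c =>
      rw [aeval_monomial, eval_monomial, Module.End.mul_apply, Module.algebraMap_end_apply,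
        mul_smul]
      congr 1
      induction i with
      | zero => simp
      | succ i ih =>
        rw [pow_succ, Module.End.mul_apply, D.rep_euler_zero_X_pow, map_smul, ih, smul_smul,
          pow_succ, mul_comm]
        simp

theorem hasSymbol_ofLaurent (hq : q ≠ 0) (f : K[X][T;T⁻¹]) :
    HasSymbol (D.rep (D.ofLaurent hq f)) 0 fun n => laurentEval hq n f := fun n =>
  ⟨by rw [D.rep_ofLaurent_X_pow hq]; simp, fun hn => by omega⟩

theorem hasSymbol_d_zero_mul (hq : q ≠ 0) {w : E} {k : ℕ} {f : K[X][T;T⁻¹]}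
    (h : HasSymbol (D.rep w) (-(k : ℤ)) fun n => laurentEval hq n f) :
    HasSymbol (D.rep (D.d 0 * w)) (-((k + 1 : ℕ) : ℤ)) fun n =>
      laurentEval hq n (LaurentPolynomial.C (X - Polynomial.C ((k : ℤ) : K)) * f) := by
  rw [map_mul, D.rep_d, show -((k + 1 : ℕ) : ℤ) = -k - 1 by push_cast; ring]
  refine (h.del_zero q).congr fun n => ?_
  simp [sub_eq_add_neg]

/-- The constant comes from (q^(n-k) - 1)/(q - 1) = (q^n - q^k)/(q^k (q - 1)). -/
theorem hasSymbol_d_one_mul (hq : q ≠ 0) (hq1 : q ≠ 1) {w : E} {k : ℕ} {f : K[X][T;T⁻¹]}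
    (h : HasSymbol (D.rep w) (-(k : ℤ)) fun n => laurentEval hq n f) :
    HasSymbol (D.rep (D.d 1 * w)) (-((k + 1 : ℕ) : ℤ)) fun n =>
      laurentEval hq n (LaurentPolynomial.C (Polynomial.C (q ^ (k : ℤ) * (q - 1))⁻¹) *
        ((T 1 - LaurentPolynomial.C (Polynomial.C (q ^ (k : ℤ)))) * f)) := by
  rw [map_mul, D.rep_d, show -((k + 1 : ℕ) : ℤ) = -k - 1 by push_cast; ring]
  refine (h.del_one hq1).congr fun n => ?_
  have : q - 1 ≠ 0 := sub_ne_zero.2 hq1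
  have hk : q ^ k ≠ 0 := pow_ne_zero _ hq
  simp only [map_mul, map_sub, laurentEval_C, laurentEval_T, Polynomial.eval_C, mul_one,
    zpow_add₀ hq, zpow_natCast, zpow_neg]
  field_simp

theorem exists_hasSymbol_of_mem_lower (hq : q ≠ 0) (hq1 : q ≠ 1) (k : ℕ) :
    ∀ w ∈ D.lower hq k, ∃ f : K[X][T;T⁻¹],
      HasSymbol (D.rep w) (-(k : ℤ)) fun n => laurentEval hq n f := by
  induction k with
  | zero => rintro _ ⟨f, rfl⟩; exact ⟨f, by simpa using D.hasSymbol_ofLaurent hq f⟩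
  | succ k ih =>
    intro w hw
    obtain ⟨u, hu, v, hv, rfl⟩ := D.mem_lower_succ.1 hw
    obtain ⟨f, hf⟩ := ih u hu
    obtain ⟨g, hg⟩ := ih v hv
    rw [map_add]
    have := (D.hasSymbol_d_zero_mul hq hf).add (D.hasSymbol_d_one_mul hq hq1 hg)
    exact ⟨_, this.congr fun n => (map_add _ _ _).symm⟩

/-- Vanishing at n = k gives f = (X-k)a + (T-q^k)b, but the induction needs cofactors that vanish at
all n < k. They are corrected with the Bézout identity 1 = (X-k)r + c⁻¹p, where p = ∏_{j<k}(X-j): f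
= (X-k)(rf + c⁻¹pa) + (T-q^k)c⁻¹pb. -/
theorem exists_mem_lower_hasSymbol [CharZero K] (hq : q ≠ 0) (hq1 : q ≠ 1) (k : ℕ) :
    ∀ f : K[X][T;T⁻¹], (∀ n : ℕ, n < k → laurentEval hq n f = 0) →
      ∃ w ∈ D.lower hq k, HasSymbol (D.rep w) (-(k : ℤ)) fun n => laurentEval hq n f := by
  induction k with
  | zero => exact fun f _ => ⟨_, ⟨f, rfl⟩, by simpa using D.hasSymbol_ofLaurent hq f⟩
  | succ k ih =>
    intro f hf
    obtain ⟨a, b, hab⟩ := exists_of_laurentEval_eq_zero hq k (hf k k.lt_succ_self)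
    let p : K[X] := ∏ j ∈ Finset.range k, (X - Polynomial.C (j : K))
    have hpj : ∀ j < k, p.eval (j : K) = 0 := fun j hj => by
      rw [eval_prod]
      exact Finset.prod_eq_zero (Finset.mem_range.2 hj) (by simp)
    have hpk : p.eval (k : K) ≠ 0 := by
      rw [eval_prod]
      refine Finset.prod_ne_zero_iff.2 fun j hj => ?_
      rw [eval_sub, eval_X, Polynomial.eval_C, sub_ne_zero, Nat.cast_injective.ne_iff]
      exact (Finset.mem_range.1 hj).ne'
    set c := p.eval (k : K) with hc
    obtain ⟨r, hr⟩ : X - Polynomial.C (k : K) ∣ 1 - Polynomial.C c⁻¹ * p := by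
      rw [dvd_iff_isRoot, IsRoot, eval_sub, eval_mul, Polynomial.eval_C, ← hc, eval_one,
        inv_mul_cancel₀ hpk, sub_self]
    have hcp : ∀ n < k, laurentEval hq n (LaurentPolynomial.C (Polynomial.C c⁻¹ * p)) = 0 :=
      fun n hn => by rw [laurentEval_C, eval_mul, Int.cast_natCast, hpj n hn, mul_zero]
    obtain ⟨u, hu, hu'⟩ := ih (LaurentPolynomial.C r * f +
        LaurentPolynomial.C (Polynomial.C c⁻¹ * p) * a) fun n hn => by
      rw [map_add, map_mul (laurentEval hq n), map_mul (laurentEval hq n), hf n (by omega),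
        hcp n hn, mul_zero, zero_mul, add_zero]
    -- The factor q^k (q-1) cancels the constant that ∂_1 contributes to the symbol.
    obtain ⟨v, hv, hv'⟩ := ih (LaurentPolynomial.C (Polynomial.C (q ^ (k : ℤ) * (q - 1))) *
        (LaurentPolynomial.C (Polynomial.C c⁻¹ * p) * b)) fun n hn => by
      rw [map_mul (laurentEval hq n), map_mul (laurentEval hq n), hcp n hn, zero_mul, mul_zero]
    refine ⟨_, D.mem_lower_succ.2 ⟨u, hu, v, hv, rfl⟩, ?_⟩
    rw [map_add]
    refine ((D.hasSymbol_d_zero_mul hq hu').add (D.hasSymbol_d_one_mul hq hq1 hv')).congr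
      fun n => ?_
    rw [← map_add]
    congr 1
    have hs : (LaurentPolynomial.C (Polynomial.C (q ^ (k : ℤ) * (q - 1))⁻¹) : K[X][T;T⁻¹]) *
        LaurentPolynomial.C (Polynomial.C (q ^ (k : ℤ) * (q - 1))) = 1 := by
      rw [← map_mul, ← map_mul, inv_mul_cancel₀
        (mul_ne_zero (zpow_ne_zero _ hq) (sub_ne_zero.2 hq1)), map_one, map_one]
    have hr' : (1 : K[X][T;T⁻¹]) - LaurentPolynomial.C (Polynomial.C c⁻¹ * p) =
        LaurentPolynomial.C (X - Polynomial.C ((k : ℤ) : K)) * LaurentPolynomial.C r := by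
      rw [← map_mul, Int.cast_natCast, ← hr, map_sub, map_one]
    linear_combination (-f) * hr' - LaurentPolynomial.C (Polynomial.C c⁻¹ * p) * hab +
      (LaurentPolynomial.C (Polynomial.C c⁻¹ * p) * b *
        (T 1 - LaurentPolynomial.C (Polynomial.C (q ^ (k : ℤ))))) * hs

/-- If ∂u + ∂_1 v acts as zero, the syzygy lemma yields a common factor a of the two symbols. An
element y with symbol a satisfies κv = x∂y and κu = -x∂_1 y, by the induction hypothesis; then κ(∂u
+ ∂_1 v) = (∂_1x∂ - ∂x∂_1)y = 0. -/
theorem eq_zero_of_mem_lower [CharZero K] (hq : q ≠ 0)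
    (hqi : Function.Injective fun b : ℤ => q ^ b) (k : ℕ) :
    ∀ w ∈ D.lower hq k, D.rep w = 0 → w = 0 := by
  have hq1 := ne_one_of_zpow_injective hqi
  induction k with
  | zero =>
    rintro _ ⟨f, rfl⟩ h
    rw [eq_zero_of_laurentEval_eq_zero hq hqi
      fun n => (D.hasSymbol_ofLaurent hq f).symbol_eq_zero h n, map_zero]
  | succ k ih =>
    intro w hw h
    obtain ⟨u, hu, v, hv, rfl⟩ := D.mem_lower_succ.1 hw
    obtain ⟨f, hf⟩ := D.exists_hasSymbol_of_mem_lower hq hq1 k u hu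
    obtain ⟨g, hg⟩ := D.exists_hasSymbol_of_mem_lower hq hq1 k v hv
    have hsum := ((D.hasSymbol_d_zero_mul hq hf).add
      (D.hasSymbol_d_one_mul hq hq1 hg)).symbol_eq_zero (by rw [← map_add, h])
    simp only [← map_add] at hsum
    have hrel := eq_zero_of_laurentEval_eq_zero hq hqi hsum
    rw [mul_left_comm] at hrel
    obtain ⟨a, hga, hfa⟩ := exists_factor_of_C_mul_add_T_sub_mul (zpow_ne_zero _ hq) hrel
    set κ : K := (q ^ (k : ℤ) * (q - 1))⁻¹ with hκ
    have hκ0 : κ ≠ 0 := inv_ne_zero (mul_ne_zero (zpow_ne_zero _ hq) (sub_ne_zero.2 hq1))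
    -- The factor a vanishes at n < k because g does, as a symbol of degree -k, and n - k ≠ 0.
    obtain ⟨y, hy, hya⟩ := D.exists_mem_lower_hasSymbol hq hq1 k a fun n hn => by
      have h1 := congrArg (laurentEval hq n) hga
      rw [map_mul, map_mul, show laurentEval hq n g = 0 from (hg n).2 (by omega), mul_zero, laurentEval_C, eval_sub, eval_X,
        Polynomial.eval_C] at h1
      refine (mul_eq_zero.1 h1.symm).resolve_left (sub_ne_zero.2 ?_)
      exact_mod_cast hn.ne
    have hdeg : (-((k + 1 : ℕ) : ℤ) + 1) = -(k : ℤ) := by push_cast; ring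
    have hv' : κ • v = D.euler 0 * y := by
      refine sub_eq_zero.1 (ih _ (Submodule.sub_mem _ (Submodule.smul_mem _ _ hv)
        (D.euler_mul_mem_lower hq hq1 0 k y hy)) ?_)
      rw [map_sub, map_smul, euler, mul_assoc, map_mul, D.rep_x, sub_eq_zero]
      have h1 := (D.hasSymbol_d_zero_mul hq hya).X_mul
      rw [hdeg] at h1
      refine (hg.smul κ).unique (h1.congr fun n => ?_)
      rw [← hga, map_mul, laurentEval_C, Polynomial.eval_C]
    have hu' : κ • u = -(D.euler 1 * y) := by
      refine eq_neg_of_add_eq_zero_left (ih _ (Submodule.add_mem _ (Submodule.smul_mem _ _ hu)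
        (D.euler_mul_mem_lower hq hq1 1 k y hy)) ?_)
      rw [map_add, map_smul, euler, mul_assoc, map_mul, D.rep_x]
      have h1 := (D.hasSymbol_d_one_mul hq hq1 hya).X_mul
      rw [hdeg] at h1
      refine (((hf.smul κ).add h1).congr fun n => ?_).unique (HasSymbol.zero _)
      rw [hfa, map_neg, map_mul (laurentEval hq n) (LaurentPolynomial.C _), laurentEval_C,
        Polynomial.eval_C]
      ring
    refine (smul_eq_zero.1 ?_).resolve_left hκ0
    rw [smul_add, ← mul_smul_comm, ← mul_smul_comm, hu', hv', mul_neg, euler, euler, ← mul_assoc,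
      ← mul_assoc, ← mul_assoc, ← mul_assoc, D.exchange 0 1, neg_add_cancel]

theorem hasSymbol_upper (hq : q ≠ 0) (k : ℕ) :
    ∀ w ∈ D.upper hq k, ∃ f : K[X][T;T⁻¹],
      HasSymbol (D.rep w) k fun n => laurentEval hq n f := by
  induction k with
  | zero => rintro _ ⟨f, rfl⟩; exact ⟨f, D.hasSymbol_ofLaurent hq f⟩
  | succ k ih =>
    intro w hw
    obtain ⟨u, hu, rfl⟩ := D.mem_upper_succ.1 hw
    obtain ⟨f, hf⟩ := ih u hu
    exact ⟨f, by rw [map_mul, D.rep_x]; exact_mod_cast hf.X_mul⟩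

theorem exists_mem_upper_hasSymbol (hq : q ≠ 0) (k : ℕ) (f : K[X][T;T⁻¹]) :
    ∃ w ∈ D.upper hq k, HasSymbol (D.rep w) k fun n => laurentEval hq n f := by
  induction k with
  | zero => exact ⟨_, ⟨f, rfl⟩, D.hasSymbol_ofLaurent hq f⟩
  | succ k ih =>
    obtain ⟨u, hu, hf⟩ := ih
    exact ⟨_, D.mem_upper_succ.2 ⟨u, hu, rfl⟩, by rw [map_mul, D.rep_x]; exact_mod_cast hf.X_mul⟩

theorem eq_zero_of_mem_upper [CharZero K] (hq : q ≠ 0)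
    (hqi : Function.Injective fun b : ℤ => q ^ b) (k : ℕ) :
    ∀ w ∈ D.upper hq k, D.rep w = 0 → w = 0 := by
  induction k with
  | zero => exact D.eq_zero_of_mem_lower hq hqi 0
  | succ k ih =>
    intro w hw h
    obtain ⟨u, hu, rfl⟩ := D.mem_upper_succ.1 hw
    rw [ih u hu ?_, mul_zero]
    rw [map_mul, D.rep_x] at h
    refine LinearMap.ext fun p => ?_
    have := LinearMap.congr_fun h p
    rw [Module.End.mul_apply, LinearMap.mulLeft_apply, LinearMap.zero_apply] at this
    exact (mul_eq_zero.1 this).resolve_left X_ne_zero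

theorem exists_hasSymbol_of_mem_homog (hq : q ≠ 0) (hq1 : q ≠ 1) {e : ℤ} {w : E}
    (hw : w ∈ D.homog hq e) : ∃ f : K[X][T;T⁻¹],
      HasSymbol (D.rep w) e fun n => laurentEval hq n f := by
  match e with
  | .ofNat k => exact D.hasSymbol_upper hq k w hw
  | .negSucc k => exact D.exists_hasSymbol_of_mem_lower hq hq1 (k + 1) w hw

theorem exists_mem_homog_hasSymbol [CharZero K] (hq : q ≠ 0) (hq1 : q ≠ 1) {e : ℤ}
    {f : K[X][T;T⁻¹]} (hf : ∀ n : ℕ, (n : ℤ) + e < 0 → laurentEval hq n f = 0) :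
    ∃ w ∈ D.homog hq e, HasSymbol (D.rep w) e fun n => laurentEval hq n f := by
  match e with
  | .ofNat k => exact D.exists_mem_upper_hasSymbol hq k f
  | .negSucc k => exact D.exists_mem_lower_hasSymbol hq hq1 (k + 1) f fun n hn => hf n (by omega)

theorem eq_zero_of_mem_homog [CharZero K] (hq : q ≠ 0)
    (hqi : Function.Injective fun b : ℤ => q ^ b) {e : ℤ} {w : E} (hw : w ∈ D.homog hq e)
    (h : D.rep w = 0) : w = 0 := by
  match e with
  | .ofNat k => exact D.eq_zero_of_mem_upper hq hqi k w hw h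
  | .negSucc k => exact D.eq_zero_of_mem_lower hq hqi (k + 1) w hw h

/-- Parts of different degree act by components that `symbolAt` separates, so each homogeneous part
of a kernel element acts as zero. -/
theorem rep_injective [CharZero K] (hq : q ≠ 0)
    (hqi : Function.Injective fun b : ℤ => q ^ b) : Function.Injective D.rep := by
  have hq1 := ne_one_of_zpow_injective hqi
  refine (injective_iff_map_eq_zero _).2 fun w hw => ?_
  have hmem : w ∈ ⨆ e, D.homog hq e := D.iSup_homog hq hq1 ▸ trivial
  obtain ⟨v, hv, rfl⟩ := (Submodule.mem_iSup_iff_exists_finsupp _ _).1 hmem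
  rw [Finsupp.sum, map_sum] at hw
  refine Finset.sum_eq_zero fun e he => D.eq_zero_of_mem_homog hq hqi (hv e) ?_
  obtain ⟨f, hf⟩ := D.exists_hasSymbol_of_mem_homog hq hq1 (hv e)
  have h0 := congrArg (symbolAt e) hw
  rw [map_sum, map_zero, Finset.sum_eq_single_of_mem e he fun e' _ hne => by
    obtain ⟨f', hf'⟩ := D.exists_hasSymbol_of_mem_homog hq hq1 (hv e')
    exact hf'.symbolAt_of_ne hne.symm, hf.symbolAt_self] at h0
  exact hf.unique ((HasSymbol.zero e).congr fun n => (congrFun h0 n).symm)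

theorem exists_symbolAt_rep (hq : q ≠ 0) (hq1 : q ≠ 1) (e : ℤ) (w : E) :
    ∃ f : K[X][T;T⁻¹], ∀ n : ℕ, symbolAt e (D.rep w) n = laurentEval hq n f := by
  have hmem : w ∈ ⨆ e, D.homog hq e := D.iSup_homog hq hq1 ▸ trivial
  induction hmem using Submodule.iSup_induction' with
  | mem e' w hw =>
    obtain ⟨f, hf⟩ := D.exists_hasSymbol_of_mem_homog hq hq1 hw
    by_cases he : e = e'
    · subst he
      exact ⟨f, fun n => congrFun hf.symbolAt_self n⟩
    · exact ⟨0, fun n => by rw [hf.symbolAt_of_ne he, map_zero]; rfl⟩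
  | zero => exact ⟨0, fun n => by simp⟩
  | add u v _ _ hu hv =>
    obtain ⟨f, hf⟩ := hu
    obtain ⟨g, hg⟩ := hv
    exact ⟨f + g, fun n => by rw [map_add, map_add, Pi.add_apply, hf, hg, map_add]⟩

end QuantumWeylRep

end

end QuantumDiff

namespace QuantumDiff

noncomputable section

open Polynomial

/-! ### The operators satisfy the relations. -/

section Operators

variable {K : Type*} [Field K] (q : K)

theorem qNumber_succ (n : ℕ) (m : K) : qNumber (n + 1) m = m * qNumber n m + 1 := by
  rw [qNumber, Finset.sum_range_succ', qNumber, Finset.mul_sum]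
  simp [pow_succ']

theorem qNumber_add (i j : ℕ) (m : K) : qNumber (i + j) m = m ^ i * qNumber j m + qNumber i m := by
  rw [qNumber, Finset.sum_range_add, qNumber, qNumber, Finset.mul_sum, add_comm]
  simp [pow_add]

/-- The geometric sum is read in reverse order. -/
theorem pow_mul_qNumber_inv {q : K} (hq : q ≠ 0) (n : ℕ) :
    q ^ n * qNumber (n + 1) q⁻¹ = qNumber (n + 1) q := by
  rw [qNumber, qNumber, ← Finset.sum_range_reflect, Finset.mul_sum]
  refine Finset.sum_congr rfl fun i hi => ?_
  have : i ≤ n := Nat.lt_succ_iff.1 (Finset.mem_range.1 hi)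
  rw [Nat.add_sub_cancel, inv_pow, ← div_eq_mul_inv, div_eq_iff (pow_ne_zero _ hq), ← pow_add,
    Nat.add_sub_cancel' this]

theorem del_mul_X (a : SignType) :
    del q a * LinearMap.mulLeft K X =
      q ^ (a : ℤ) • (LinearMap.mulLeft K X * del q a) + 1 := by
  refine HasSymbol.ext_of_X_pow fun n => ?_
  rw [LinearMap.add_apply, LinearMap.smul_apply, Module.End.mul_apply, Module.End.mul_apply,
    LinearMap.mulLeft_apply, ← pow_succ', del_X_pow, del_X_pow, map_smul, LinearMap.mulLeft_apply,
    qNumber_succ, add_smul, one_smul, smul_smul, Module.End.one_apply, add_tsub_cancel_right]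
  cases n with
  | zero => simp [qNumber]
  | succ n => rw [add_tsub_cancel_right, pow_succ']

theorem del_X_del (a b : SignType) :
    del q a * LinearMap.mulLeft K X * del q b = del q b * LinearMap.mulLeft K X * del q a := by
  refine HasSymbol.ext_of_X_pow fun n => ?_
  simp only [Module.End.mul_apply, del_X_pow, map_smul, LinearMap.mulLeft_apply]
  cases n with
  | zero => simp [qNumber]
  | succ n =>
    rw [add_tsub_cancel_right, ← pow_succ', del_X_pow, del_X_pow, smul_comm]

theorem del_neg_one_mul_del_one {q : K} (hq : q ≠ 0) :
    del q (-1) * del q 1 = q • (del q 1 * del q (-1)) := by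
  refine HasSymbol.ext_of_X_pow fun n => ?_
  simp only [LinearMap.smul_apply, Module.End.mul_apply, del_X_pow, map_smul, smul_smul]
  congr 1
  simp only [SignType.coe_neg, SignType.coe_one, zpow_neg, zpow_one]
  match n with
  | 0 => simp [qNumber]
  | 1 => simp [qNumber]
  | n + 2 =>
    rw [add_tsub_cancel_right (n + 1) 1, ← pow_mul_qNumber_inv hq (n + 1),
      ← pow_mul_qNumber_inv hq n]
    ring

/-- The operators corresponding to the generators of the presented algebra. -/
def genOp : Gen → Module.End K K[X]
  | .x => LinearMap.mulLeft K X
  | .d a => del q a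

/-- The representation of the presented algebra on `K[X]`. -/
def presentedRep {q : K} (hq : q ≠ 0) : PresentedAlg q →ₐ[K] Module.End K K[X] :=
  RingQuot.liftAlgHom K ⟨FreeAlgebra.lift K (genOp q), by
    rintro _ _ (a | ⟨a, b, hab⟩ | _)
    · simp [genOp, del_mul_X]
    · simp [genOp, del_X_del q a b]
    · simp [genOp, del_neg_one_mul_del_one hq]⟩

theorem presentedRep_gen {q : K} (hq : q ≠ 0) (g : Gen) :
    presentedRep hq (PresentedAlg.gen q g) = genOp q g := by
  rw [presentedRep, PresentedAlg.gen, RingQuot.liftAlgHom_mkAlgHom_apply, FreeAlgebra.lift_ι_apply]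

/-- The presented algebra with its representation. -/
def presentedWeylRep {q : K} (hq : q ≠ 0) : QuantumWeylRep q (PresentedAlg q) where
  x := PresentedAlg.gen q .x
  d a := PresentedAlg.gen q (.d a)
  rep := presentedRep hq
  weyl a := by
    have := RingQuot.mkAlgHom_rel K (Rel.weyl (q := q) a)
    rw [map_sub, map_smul, map_mul, map_mul, map_one] at this
    exact sub_eq_iff_eq_add'.1 this
  exchange a b := by
    by_cases hab : a = b
    · rw [hab]
    · have := RingQuot.mkAlgHom_rel K (Rel.exchange (q := q) a b hab)
      rw [map_mul, map_mul, map_mul, map_mul] at this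
      exact this
  qcomm := by
    have := RingQuot.mkAlgHom_rel K (Rel.qcomm (q := q))
    rw [map_mul, map_smul, map_mul] at this
    exact this
  rep_x := presentedRep_gen hq _
  rep_d a := presentedRep_gen hq _
  adjoin_eq_top := by
    have h : insert (PresentedAlg.gen q .x) (Set.range fun a => PresentedAlg.gen q (.d a)) =
        RingQuot.mkAlgHom K (Rel q) '' Set.range (FreeAlgebra.ι K) := by
      ext y
      constructor
      · rintro (rfl | ⟨a, rfl⟩)
        · exact ⟨_, ⟨_, rfl⟩, rfl⟩
        · exact ⟨_, ⟨_, rfl⟩, rfl⟩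
      · rintro ⟨_, ⟨_ | a, rfl⟩, rfl⟩
        · exact Or.inl rfl
        · exact Or.inr ⟨a, rfl⟩
    rw [h, ← AlgHom.map_adjoin, FreeAlgebra.adjoin_range_ι, Algebra.map_top,
      AlgHom.range_eq_top]
    exact RingQuot.mkAlgHom_surjective K (Rel q)

end Operators

/-! ### Quantum differential operators coincide with the image of E. -/

section DiffOps

variable {K : Type*} [Field K] {q : K}

theorem exists_eq_smul_X_pow_of_mem_polyGrading {e : ℤ} {p : K[X]} (hp : p ∈ polyGrading K e) :
    ∃ c : K, p = c • X ^ e.toNat ∧ (e < 0 → c = 0) := by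
  induction hp using Submodule.span_induction with
  | mem p hp =>
    obtain ⟨n, rfl, rfl⟩ := hp
    exact ⟨1, by simp, fun h => by omega⟩
  | zero => exact ⟨0, by simp, fun _ => rfl⟩
  | add p r _ _ hp hr =>
    obtain ⟨c, rfl, hc⟩ := hp
    obtain ⟨d, rfl, hd⟩ := hr
    exact ⟨c + d, by rw [add_smul], fun h => by rw [hc h, hd h, add_zero]⟩
  | smul b p _ hp =>
    obtain ⟨c, rfl, hc⟩ := hp
    exact ⟨b * c, by rw [mul_smul], fun h => by rw [hc h, mul_zero]⟩

theorem exists_hasSymbol_of_isHomogeneousMap {φ : Module.End K K[X]}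
    (h : IsHomogeneousMap (polyGrading K) φ) : ∃ e f, HasSymbol φ e f := by
  obtain ⟨e, he⟩ := h
  choose f hf using fun n : ℕ =>
    exists_eq_smul_X_pow_of_mem_polyGrading (he n (X ^ n) (X_pow_mem_polyGrading K n))
  exact ⟨e, f, fun n => by rw [add_comm]; exact hf n⟩

theorem sigma_X_pow (hq : q ≠ 0) (a : ℤ) (m : ℕ) :
    sigma (polyGrading K) (qBicharacter q hq) a (X ^ m) = q ^ (a * m) • X ^ m := by
  rw [sigma_of_mem (X_pow_mem_polyGrading K m)]
  simp [qBicharacter]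

theorem hasSymbol_bracket_X (hq : q ≠ 0) (a : ℤ) {φ : Module.End K K[X]} {e : ℤ} {f : ℕ → K}
    (h : HasSymbol φ e f) :
    HasSymbol (bracket (polyGrading K) (qBicharacter q hq) a φ X) (e + 1)
      fun n => f (n + 1) - q ^ a * f n := by
  have hb : bracket (polyGrading K) (qBicharacter q hq) a φ X =
      φ * LinearMap.mulLeft K X + (-q ^ a) • (LinearMap.mulLeft K X * φ) := by
    have := sigma_X_pow hq a 1
    rw [pow_one] at this
    rw [bracket, this]
    ext n : 2
    simp [sub_eq_add_neg]
  rw [hb]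
  exact (h.of_X_mul.add (h.X_mul.smul _)).congr fun n => by ring

/-- The bracket with X alone suffices: its symbol is the twisted difference of the symbol of φ,
which is therefore a quasi-polynomial. Its zeros where n + e < 0 are exactly what is needed to
realise it in E. -/
theorem QuantumWeylRep.mem_range_of_bracket_X_mem [CharZero K] {E : Type*} [Ring E] [Algebra K E]
    (D : QuantumWeylRep q E) (hq : q ≠ 0) (hq1 : q ≠ 1) {φ : Module.End K K[X]}
    (hφ : IsHomogeneousMap (polyGrading K) φ) {a : ℤ}
    (h : bracket (polyGrading K) (qBicharacter q hq) a φ X ∈ D.rep.range) : φ ∈ D.rep.range := by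
  obtain ⟨e, g, hg⟩ := exists_hasSymbol_of_isHomogeneousMap hφ
  have hb := hasSymbol_bracket_X hq a hg
  obtain ⟨w, hw⟩ := h
  obtain ⟨u, hu⟩ := D.exists_symbolAt_rep hq hq1 (e + 1) w
  change D.rep w = _ at hw
  rw [hw, hb.symbolAt_self] at hu
  obtain ⟨f, hf⟩ := exists_laurentEval_eq_of_difference hq a u hu
  obtain ⟨v, -, hv⟩ := D.exists_mem_homog_hasSymbol hq hq1 (e := e) (f := f)
    fun n hn => by rw [← hf, (hg n).2 hn]
  exact ⟨v, hv.unique (hg.congr hf)⟩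

theorem QuantumWeylRep.mulLeft_mem_range {E : Type*} [Ring E] [Algebra K E]
    (D : QuantumWeylRep q E) (r : K[X]) : LinearMap.mulLeft K r ∈ D.rep.range := by
  refine ⟨aeval D.x r, ?_⟩
  change D.rep _ = _
  rw [← aeval_algHom_apply, D.rep_x]
  change aeval (Algebra.lmul K K[X] X) r = Algebra.lmul K K[X] r
  rw [aeval_algHom_apply, aeval_X_left_apply]

theorem QuantumWeylRep.layer_le_range [CharZero K] {E : Type*} [Ring E] [Algebra K E]
    (D : QuantumWeylRep q E) (hq : q ≠ 0) (hq1 : q ≠ 1) (i : ℕ) :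
    layer (polyGrading K) (qBicharacter q hq) i ≤ Subalgebra.toSubmodule D.rep.range := by
  induction i with
  | zero => exact bot_le
  | succ i ih =>
    refine Submodule.span_le.2 ?_
    rintro _ ⟨φ, ⟨hφ, a, ha⟩, r, s, rfl⟩
    exact D.rep.range.mul_mem (D.rep.range.mul_mem (D.mulLeft_mem_range r)
      (D.mem_range_of_bracket_X_mem hq hq1 hφ (ih (ha X)))) (D.mulLeft_mem_range s)

/-- The twisted Leibniz rule. -/
theorem del_mul (hq : q ≠ 0) (a : SignType) (r s : K[X]) :
    del q a (r * s) =
      sigma (polyGrading K) (qBicharacter q hq) a r * del q a s + del q a r * s := by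
  induction r using Polynomial.induction_on' with
  | add r r' h h' => rw [add_mul, map_add, h, h', map_add, map_add, add_mul, add_mul]; abel
  | monomial m c =>
  induction s using Polynomial.induction_on' with
  | add s s' h h' => rw [mul_add, map_add, h, h', map_add, mul_add, mul_add]; abel
  | monomial n d =>
  rw [← C_mul_X_pow_eq_monomial, ← C_mul_X_pow_eq_monomial, ← smul_eq_C_mul, ← smul_eq_C_mul]
  simp only [map_smul, smul_mul_assoc, mul_smul_comm, ← smul_add]
  congr 2
  rw [sigma_X_pow, ← pow_add, del_X_pow, del_X_pow, del_X_pow, qNumber_add, add_smul, zpow_mul,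
    zpow_natCast, smul_mul_assoc, smul_mul_assoc, mul_smul_comm, mul_smul, ← pow_add, ← pow_add]
  congr 1
  · cases n with
    | zero => simp [qNumber]
    | succ n => rw [add_tsub_cancel_right]; rfl
  · cases m with
    | zero => simp [qNumber]
    | succ m => congr 2; omega

/-- By the twisted Leibniz rule the bracket [∂_a, r]_a is multiplication by ∂_a(r), of order 0; so
∂_a has order at most 1. -/
theorem del_mem_diffOps (hq : q ≠ 0) (a : SignType) :
    del q a ∈ diffOps (polyGrading K) (qBicharacter q hq) := by
  refine ⟨1, mem_bimoduleSpan ⟨⟨-1, fun e r hr => ?_⟩, a, fun r => ?_⟩⟩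
  · obtain ⟨c, rfl, hc⟩ := exists_eq_smul_X_pow_of_mem_polyGrading hr
    rcases lt_trichotomy e 0 with he | rfl | he
    · rw [hc he]; simp
    · rw [map_smul, del_X_pow]; simp [qNumber]
    · rw [map_smul, del_X_pow, show -1 + e = ((e.toNat - 1 : ℕ) : ℤ) by omega]
      exact Submodule.smul_mem _ _ (Submodule.smul_mem _ _ (X_pow_mem_polyGrading K _))
  · have : bracket (polyGrading K) (qBicharacter q hq) a (del q a) r =
        LinearMap.mulLeft K (del q a r) := by
      refine LinearMap.ext fun s => ?_
      rw [bracket, LinearMap.sub_apply, Module.End.mul_apply, Module.End.mul_apply,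
        LinearMap.mulLeft_apply, LinearMap.mulLeft_apply, LinearMap.mulLeft_apply, del_mul hq,
        add_sub_cancel_left]
    rw [this]
    exact mulLeft_mem_diffOpsOfOrder _

theorem adjoin_le_diffOps (hq : q ≠ 0) :
    Algebra.adjoin K ({LinearMap.mulLeft K (X : K[X]), del q 1, del q (-1), del q 0} :
      Set (Module.End K K[X])) ≤ diffOps (polyGrading K) (qBicharacter q hq) := by
  refine Algebra.adjoin_le ?_
  rintro _ (rfl | rfl | rfl | rfl)
  · exact ⟨0, mulLeft_mem_diffOpsOfOrder _⟩
  all_goals exact del_mem_diffOps hq _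

theorem QuantumWeylRep.range_rep {E : Type*} [Ring E] [Algebra K E] (D : QuantumWeylRep q E) :
    D.rep.range = Algebra.adjoin K
      ({LinearMap.mulLeft K (X : K[X]), del q 1, del q (-1), del q 0} :
        Set (Module.End K K[X])) := by
  rw [← Algebra.map_top, ← D.adjoin_eq_top, AlgHom.map_adjoin, Set.image_insert_eq, D.rep_x,
    ← Set.range_comp]
  congr 2
  ext φ
  constructor
  · rintro ⟨a, rfl⟩
    rw [Function.comp_apply, D.rep_d]
    match a with
    | 1 => exact Or.inl rfl
    | -1 => exact Or.inr (Or.inl rfl)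
    | 0 => exact Or.inr (Or.inr rfl)
  · rintro (rfl | rfl | rfl) <;> exact ⟨_, D.rep_d _⟩

theorem diffOps_le_range_rep [CharZero K] {E : Type*} [Ring E] [Algebra K E]
    (D : QuantumWeylRep q E) (hq : q ≠ 0) (hq1 : q ≠ 1) :
    diffOps (polyGrading K) (qBicharacter q hq) ≤ D.rep.range := by
  rintro φ ⟨i, hi⟩
  rw [diffOpsOfOrder_eq_layer] at hi
  exact D.layer_le_range hq hq1 _ hi

theorem zpow_injective_of_transcendental [CharZero K] (hq : Transcendental ℚ q) :
    Function.Injective fun b : ℤ => q ^ b := by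
  have h0 := ne_zero_of_transcendental hq
  have hpow : ∀ n : ℕ, q ^ n = 1 → n = 0 := by
    intro n hn
    by_contra hn0
    -- If q^n = 1 with n > 0, then q is algebraic, as a root of X^n - 1.
    refine hq ⟨X ^ n - Polynomial.C 1, X_pow_sub_C_ne_zero (Nat.pos_of_ne_zero hn0) 1, ?_⟩
    simp [hn]
  intro b c hbc
  have h1 : q ^ (b - c) = 1 := by
    rw [zpow_sub₀ h0]
    exact (div_eq_one_iff_eq (zpow_ne_zero _ h0)).2 hbc
  have h2 : q ^ (b - c).natAbs = 1 := by
    rcases Int.natAbs_eq (b - c) with h | h <;> rw [h] at h1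
    · exact_mod_cast h1
    · rw [zpow_neg, inv_eq_one] at h1
      exact_mod_cast h1
  have := hpow _ h2
  omega

end DiffOps

end

end QuantumDiff

open QuantumDiff Polynomial in
theorem mainTheorem6 {K : Type*} [Field K] [CharZero K] (q : K) (hq : Transcendental ℚ q) :
    Algebra.adjoin K
        ({LinearMap.mulLeft K (X : K[X]), del q 1, del q (-1), del q 0} :
          Set (Module.End K K[X])) =
      diffOps (polyGrading K) (qBicharacter q (ne_zero_of_transcendental hq)) ∧
    ∃ θ : PresentedAlg q ≃ₐ[K] diffOps (polyGrading K) (qBicharacter q (ne_zero_of_transcendental hq)),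
      (θ (PresentedAlg.gen q Gen.x) : Module.End K K[X]) = LinearMap.mulLeft K (X : K[X]) ∧
      ∀ a : SignType, (θ (PresentedAlg.gen q (Gen.d a)) : Module.End K K[X]) = del q a := by
  have hq0 := ne_zero_of_transcendental hq
  have hqi := zpow_injective_of_transcendental hq
  let D := presentedWeylRep hq0
  have hle := diffOps_le_range_rep D hq0 (ne_one_of_zpow_injective hqi)
  have hadj : Algebra.adjoin K
      ({LinearMap.mulLeft K (X : K[X]), del q 1, del q (-1), del q 0} :
        Set (Module.End K K[X])) = diffOps (polyGrading K) (qBicharacter q hq0) :=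
    le_antisymm (adjoin_le_diffOps hq0) (D.range_rep ▸ hle)
  refine ⟨hadj, (AlgEquiv.ofInjective D.rep (D.rep_injective hq0 hqi)).trans
    (Subalgebra.equivOfEq _ _ (D.range_rep.trans hadj)), D.rep_x, D.rep_d⟩
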